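/- Let $P$ be a probability measure on a measurable space $\Xi$, let $\ell:\mathbb R^d\times\Xi\to\mathbb R$ be a loss function (measurable in $\xi$), let $\lambda>0$, and let $G,L,M,\sigma\ge 0$. Assume: (i) for every $\xi$, $\ell(\cdot,\xi)$ is $G$-Lipschitz and $L$-smooth (differentiable with $L$-Lipschitz gradient); (ii) $\psi:\mathbb R\to[0,\infty]$ is convex with $\psi(1)=0$ and $\psi(t)=+\infty$ for $t<0$, and its conjugate $\psi^*(t)=\sup_{s\in\mathbb R}(st-\psi(s))$ is finite and $M$-smooth on $\mathbb R$; (iii) for every $x$, $\ell(x,\cdot)$ is $P$-integrable and has variance at most $\sigma^2$ under $P$. Let $$\Psi(x)=\sup_{Q\ll P}\Big\{\mathbb E_{\xi\sim Q}[\ell(x,\xi)]-\lambda\int\psi\Big(\frac{dQ}{dP}\Big)\,dP\Big\}$$ (the supremum over probability measures $Q$; those of infinite divergence contribute $-\infty$) be the penalized $\psi$-divergence DRO objective, and for $w=(x,\eta)\in\mathbb R^d\times\mathbb R$ let $$\widehat{\mathcal L}(w,\xi)=\lambda\psi^*\Big(\frac{\ell(x,\xi)-G\eta}{\lambda}\Big)+G\eta,\qquad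 \widehat{\mathcal L}(w)=\mathbb E_{\xi\sim P}\,\widehat{\mathcal L}(w,\xi)$$ be the rescaled dual objective. Algorithm SNM (mini-batch normalized SGD with momentum), with initial point $w_0$, initial momentum $m_0$, learning rate $\gamma$, momentum factor $\beta$, batch size $S$ and $T$ iterations, computes for $t=1,\dots,T$ $$m_t=\beta m_{t-1}+(1-\beta)\frac1S\sum_{i=1}^S\nabla\widehat{\mathcal L}(w_{t-1},\xi_{t-1}^{(i)}),\qquad w_t=w_{t-1}-\gamma\frac{m_t}{\|m_t\|},$$ where the $\xi_{t}^{(i)}$ are i.i.d. with law $P$ (and $w_t=w_{t-1}$ if $m_t=0$). It is run with $m_0=\nabla\widehat{\mathcal L}(w_0)$. Its gradient complexity is the number $ST$ of stochastic gradients that it evaluates. Then $\Psi$ is finite and differentiable, and there are an absolute constant batch size $S\ge1$ and an absolute constant $C>0$ with the following property. For all $G,L,M,\sigma,\lambda$ as above, all $\Delta\ge0$ and all $\epsilon>0$ there are $\gamma>0$, $\beta\in[0,1)$ and a number of iterations $T\ge0$, depending only on $G,L,M,\sigma,\lambda,\Delta,\epsilon$, such that, for every problem satisfying (i)-(iii)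 for which $\widehat{\mathcal L}$ is bounded below and every $w_0$ with $\widehat{\mathcal L}(w_0)-\inf_w\widehat{\mathcal L}(w)\le\Delta$, the iterates $w_t=(x_t,\eta_t)$ of SNM satisfy $$\frac1{T+1}\sum_{t=0}^{T}\mathbb E\|\nabla\Psi(x_t)\|\le\epsilon,$$ that is, SNM finds an $\epsilon$-stationary point of $\Psi$ in expectation, with gradient complexity $$ST\le C\,G^2\left(M^2\sigma^2\lambda^{-2}+1\right)\left(\lambda^{-1}MG^2+L\right)\Delta\,\epsilon^{-4}.$$ -/

import Mathlib

open MeasureTheory ProbabilityTheory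
open scoped ENNReal BigOperators

noncomputable section

namespace DRO

/-- A function on a Hilbert space is `L`-smooth if it is differentiable and its gradient is
`L`-Lipschitz. -/
def IsSmoothWith {E : Type*} [NormedAddCommGroup E] [InnerProductSpace ℝ E] [CompleteSpace E]
    (L : ℝ) (f : E → ℝ) : Prop :=
  Differentiable ℝ f ∧ ∀ x y, ‖gradient f x - gradient f y‖ ≤ L * ‖x - y‖

/-- A divergence function `ψ : ℝ → [0, ∞]`: convex (as an extended-valued function),
`ψ 1 = 0`, and `ψ = ∞` on the negative half-line. -/
structure IsDivergenceFunction (ψ : ℝ → ℝ≥0∞) : Prop where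
  convex : ∀ s t a b : ℝ, 0 ≤ a → 0 ≤ b → a + b = 1 →
    ψ (a * s + b * t) ≤ ENNReal.ofReal a * ψ s + ENNReal.ofReal b * ψ t
  one : ψ 1 = 0
  neg : ∀ t < 0, ψ t = ⊤

/-- The conjugate `ψ*(t) = sup_s (s t - ψ s)`, with values in the extended reals. -/
def conjugate (ψ : ℝ → ℝ≥0∞) (t : ℝ) : EReal :=
  ⨆ s : ℝ, ((s * t : ℝ) : EReal) - (ψ s : EReal)

/-- The conjugate as a real function (used where the conjugate is finite). -/
def conjugateReal (ψ : ℝ → ℝ≥0∞) (t : ℝ) : ℝ := (conjugate ψ t).toReal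

/-- The conjugate of `ψ` is a (finite) `M`-smooth function on `ℝ`. -/
def HasSmoothConjugate (M : ℝ) (ψ : ℝ → ℝ≥0∞) : Prop :=
  (∀ t, conjugate ψ t ≠ ⊥ ∧ conjugate ψ t ≠ ⊤) ∧ IsSmoothWith M (conjugateReal ψ)

/-- The decision space `ℝ^d`. -/
abbrev Param (d : ℕ) : Type := EuclideanSpace ℝ (Fin d)

/-- The space `ℝ^d × ℝ` of pairs `(x, η)` with its Euclidean norm. -/
abbrev DualParam (d : ℕ) : Type := WithLp 2 (Param d × ℝ)

section Objective

variable {Ξ : Type*} [MeasurableSpace Ξ] {d : ℕ}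

/-- For every sample, the loss is `G`-Lipschitz and `L`-smooth in the decision variable. -/
structure IsLipschitzSmoothLoss (G L : ℝ) (loss : Param d → Ξ → ℝ) : Prop where
  lipschitz : ∀ ξ x y, |loss x ξ - loss y ξ| ≤ G * ‖x - y‖
  smooth : ∀ ξ, IsSmoothWith L (fun x => loss x ξ)

/-- At every decision, the loss is an integrable random variable with variance at most `σ ^ 2`
(`evariance` is the `[0, ∞]`-valued variance). -/
structure HasVarianceBound (σ : ℝ) (P : Measure Ξ) (loss : Param d → Ξ → ℝ) : Prop where
  measurable : ∀ x, Measurable (loss x)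
  integrable : ∀ x, Integrable (loss x) P
  variance_le : ∀ x, evariance (loss x) P ≤ ENNReal.ofReal (σ ^ 2)

/-- The `ψ`-divergence `d_ψ(Q, P) = ∫ ψ(dQ/dP) dP`, for `Q ≪ P`. -/
def psiDivergence (ψ : ℝ → ℝ≥0∞) (Q P : Measure Ξ) : ℝ≥0∞ :=
  ∫⁻ ξ, ψ (Q.rnDeriv P ξ).toReal ∂P

/-- The penalized DRO objective
`Ψ(x) = sup_Q { E_Q[loss(x, ξ)] - lam * d_ψ(Q, P) }`, the supremum being over the probability
measures `Q ≪ P`. A measure of infinite divergence contributes `-∞`. -/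
def penalizedObjective (loss : Param d → Ξ → ℝ) (ψ : ℝ → ℝ≥0∞) (lam : ℝ) (P : Measure Ξ)
    (x : Param d) : EReal :=
  ⨆ (Q : Measure Ξ) (_ : IsProbabilityMeasure Q) (_ : Q ≪ P),
    ((∫ ξ, loss x ξ ∂Q : ℝ) : EReal) - (lam : EReal) * (psiDivergence ψ Q P : EReal)

/-- The penalized DRO objective as a real function (used where it is finite). -/
def penalizedObjectiveReal (loss : Param d → Ξ → ℝ) (ψ : ℝ → ℝ≥0∞) (lam : ℝ) (P : Measure Ξ)
    (x : Param d) : ℝ :=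
  (penalizedObjective loss ψ lam P x).toReal

/-- The stochastic rescaled dual objective
`lam * ψ*((loss(x, ξ) - G η) / lam) + G η` at `w = (x, η)` and the sample `ξ`. -/
def rescaledDualSample (loss : Param d → Ξ → ℝ) (ψ : ℝ → ℝ≥0∞) (lam G : ℝ)
    (w : DualParam d) (ξ : Ξ) : ℝ :=
  lam * conjugateReal ψ ((loss w.fst ξ - G * w.snd) / lam) + G * w.snd

/-- The rescaled dual objective: the expectation under `P` of its stochastic version. -/
def rescaledDual (loss : Param d → Ξ → ℝ) (ψ : ℝ → ℝ≥0∞) (lam G : ℝ) (P : Measure Ξ)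
    (w : DualParam d) : ℝ :=
  ∫ ξ, rescaledDualSample loss ψ lam G w ξ ∂P

end Objective

section Algorithm

variable {W : Type*} [NormedAddCommGroup W] [InnerProductSpace ℝ W] [CompleteSpace W]
  {Ξ : Type*}

/-- State of mini-batch normalized SGD with momentum: the iterate, the momentum and the number
of stochastic gradients evaluated so far. -/
structure SNMState (W : Type*) where
  point : W
  momentum : W
  gradCalls : ℕ

/-- The mini-batch gradient `S⁻¹ ∑ᵢ ∇ f(w, ξᵢ)`. -/
def batchGradient (f : W → Ξ → ℝ) {S : ℕ} (batch : Fin S → Ξ) (w : W) : W :=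
  (S : ℝ)⁻¹ • ∑ i, gradient (fun v => f v (batch i)) w

/-- One iteration: a fresh batch of `S` stochastic gradients is evaluated at the current point,
the momentum is updated, and a step of length `γ` is made against its direction
(no step if the momentum is zero). -/
def snmStep (f : W → Ξ → ℝ) (γ β : ℝ) {S : ℕ} (batch : Fin S → Ξ) (s : SNMState W) :
    SNMState W :=
  let m : W := β • s.momentum + (1 - β) • batchGradient f batch s.point
  { point := s.point - (γ / ‖m‖) • m
    momentum := m
    gradCalls := s.gradCalls + S }

/-- Mini-batch normalized SGD with momentum on the stochastic objective `f`, with initial point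
`w₀`, initial momentum `m₀`, learning rate `γ`, momentum factor `β` and batch size `S`;
`sample t` is the batch drawn at the point reached after `t` iterations. -/
def snm (f : W → Ξ → ℝ) (w₀ m₀ : W) (γ β : ℝ) {S : ℕ} (sample : ℕ → Fin S → Ξ) :
    ℕ → SNMState W
  | 0 => { point := w₀, momentum := m₀, gradCalls := 0 }
  | t + 1 => snmStep f γ β (sample t) (snm f w₀ m₀ γ β sample t)

/-- The random batches `sample t i` (time `t`, position `i`) are independent with common
law `P`. -/
structure IsIIDSample {Ω Ξ : Type*} [MeasurableSpace Ω] [MeasurableSpace Ξ] (μ : Measure Ω)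
    (P : Measure Ξ) {S : ℕ} (sample : ℕ → Fin S → Ω → Ξ) : Prop where
  measurable : ∀ t i, Measurable (sample t i)
  law : ∀ t i, μ.map (sample t i) = P
  indep : iIndepFun (fun p : ℕ × Fin S => sample p.1 p.2) μ

end Algorithm

end DRO

end

/-! Write φ = ψ*. The dual variable c = Gη gives each sample the weight φ'((ℓ(x,ξ) - c)/λ), and the
gradient of the rescaled dual L̂ has components E[weight · ∇ℓ] and G(1 - E[weight]). The gradient of
Ψ at x is E[q ∇ℓ] for an optimal density q. Since φ' is monotone, the weight for any c lies entirely
above or entirely below q, so their L¹ distance is |E[weight] - 1|. Hence ‖∇Ψ(x)‖ ≤ ‖∂ₓL̂‖ + |∂_ηL̂|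
≤ √2 ‖∇L̂(x,η)‖ for every η, and it suffices to make the dual gradient small
(`exists_optimal_density`, `norm_gradient_penalizedObjectiveReal_le_norm_dualGrad`).

The dual need not have a Lipschitz gradient or noise of bounded variance, but both defects are
controlled by E[weight] ≤ 1 + ‖∇L̂‖/G. The smoothness constant is at most K₀ + K₁‖∇L̂‖ with K₀ =
4MG²/λ + L and K₁ = L/G, and the noise variance at most Λ² + 2‖∇L̂‖² with Λ² = 2G²(M²σ²/λ² + 1)
(`isStochasticObjective`).

Normalized steps have length at most γ, so for small γK₁ the growth of the smoothness is absorbed by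
the descent. The noise is split according to the current gradient. Where ‖∇L̂‖ ≤ Λ, its variance is
at most 3Λ²/S, and orthogonality of the increments lets the momentum reduce this by the factor 1 -
β. Elsewhere a constant batch brings its mean norm below ‖∇L̂‖/16, which the descent absorbs
(`sum_norm_gradient_le`, `movingAverage_snm`, `largeNoise_snm`). With 1 - β = ε²/Λ² and γ = (1 -
β)ε/(24K₀), about Δ/(γε), that is K₀Λ²Δ/ε⁴, iterations suffice. If G ≤ ε none is needed, because
‖∇Ψ‖ ≤ G. -/

namespace DRO

/-! ### Gradients and quadratic error bounds. -/

section Gradient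

variable {E : Type*} [NormedAddCommGroup E] [InnerProductSpace ℝ E] [CompleteSpace E]

/-- A quadratic bound on the error of a linear approximation gives the gradient. -/
theorem hasGradientAt_of_abs_sub_le_sq {f : E → ℝ} {x g : E} {K : ℝ}
    (h : ∀ y, |f y - f x - inner ℝ g (y - x)| ≤ K * ‖y - x‖ ^ 2) : HasGradientAt f g x := by
  rw [hasGradientAt_iff_isLittleO]
  have h1 : (fun y => f y - f x - inner ℝ g (y - x)) =O[nhds x] fun y => ‖y - x‖ ^ 2 := by
    refine Asymptotics.IsBigO.of_bound K (Filter.Eventually.of_forall fun y => ?_)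
    simpa using h y
  refine h1.trans_isLittleO ?_
  have h2 : (fun v : E => ‖v‖ ^ 2) =o[nhds 0] fun v : E => v := by
    have := (Asymptotics.isLittleO_norm_pow_id (E' := E) one_lt_two)
    simpa using this
  have h3 : Filter.Tendsto (fun y : E => y - x) (nhds x) (nhds 0) := by
    have : Continuous fun y : E => y - x := by fun_prop
    simpa using this.tendsto x
  exact h2.comp_tendsto h3

/-- The error of the linear approximation of a function whose gradient is Lipschitz at `x`. -/
theorem abs_sub_sub_inner_le {f : E → ℝ} {x y : E} {K : ℝ} (hf : Differentiable ℝ f)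
    (hK : 0 ≤ K) (h : ∀ z, ‖gradient f z - gradient f x‖ ≤ K * ‖z - x‖) :
    |f y - f x - inner ℝ (gradient f x) (y - x)| ≤ K * ‖y - x‖ ^ 2 := by
  have key := (convex_segment x y).norm_image_sub_le_of_norm_fderiv_le' (𝕜 := ℝ) (f := f)
    (φ := fderiv ℝ f x) (C := K * ‖y - x‖) (fun z _ => hf z) ?_
    (left_mem_segment ℝ x y) (right_mem_segment ℝ x y)
  · rw [inner_gradient_left, ← Real.norm_eq_abs]
    calc _ ≤ K * ‖y - x‖ * ‖y - x‖ := key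
      _ = _ := by ring
  · intro z hz
    have e : fderiv ℝ f z - fderiv ℝ f x
        = InnerProductSpace.toDual ℝ E (gradient f z - gradient f x) := by
      simp [map_sub]
    rw [e, LinearIsometryEquiv.norm_map]
    refine (h z).trans (mul_le_mul_of_nonneg_left ?_ hK)
    have := norm_sub_le_of_mem_segment hz
    simpa using this

end Gradient

/-! ### The conjugate φ = ψ* and its derivative. -/

section Conjugate

variable {ψ : ℝ → ℝ≥0∞} {M : ℝ}

theorem coe_conjugateReal (hc : HasSmoothConjugate M ψ) (t : ℝ) :
    ((conjugateReal ψ t : ℝ) : EReal) = conjugate ψ t :=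
  EReal.coe_toReal (hc.1 t).2 (hc.1 t).1

/-- The Fenchel-Young inequality. -/
theorem mul_sub_toReal_le_conjugateReal (hc : HasSmoothConjugate M ψ) {s : ℝ} (hs : ψ s ≠ ⊤)
    (t : ℝ) : s * t - (ψ s).toReal ≤ conjugateReal ψ t := by
  have h : ((s * t : ℝ) : EReal) - (ψ s : EReal) ≤ conjugate ψ t :=
    le_iSup (fun s : ℝ => ((s * t : ℝ) : EReal) - (ψ s : EReal)) s
  rw [← coe_conjugateReal hc, ← ENNReal.ofReal_toReal hs, EReal.coe_ennreal_ofReal,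
    max_eq_left ENNReal.toReal_nonneg, ← EReal.coe_sub, EReal.coe_le_coe_iff] at h
  exact h

theorem ofReal_mul_sub_conjugateReal_le (hc : HasSmoothConjugate M ψ) (s t : ℝ) :
    ENNReal.ofReal (s * t - conjugateReal ψ t) ≤ ψ s := by
  by_cases hs : ψ s = ⊤
  · simp [hs]
  · rw [← ENNReal.ofReal_toReal hs]
    exact ENNReal.ofReal_le_ofReal (by linarith [mul_sub_toReal_le_conjugateReal hc hs t])

theorem exists_lt_mul_sub_toReal (hψ : IsDivergenceFunction ψ) (hc : HasSmoothConjugate M ψ)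
    (t : ℝ) {δ : ℝ} (hδ : 0 < δ) :
    ∃ s, 0 ≤ s ∧ ψ s ≠ ⊤ ∧ conjugateReal ψ t - δ < s * t - (ψ s).toReal := by
  have h : ((conjugateReal ψ t - δ : ℝ) : EReal) < conjugate ψ t := by
    rw [← coe_conjugateReal hc, EReal.coe_lt_coe_iff]; linarith
  obtain ⟨s, hs⟩ := lt_iSup_iff.1 h
  have htop : ψ s ≠ ⊤ := by
    intro h0
    simp [h0] at hs
  refine ⟨s, ?_, htop, ?_⟩
  · by_contra! h0
    exact htop (hψ.neg s h0)
  · rw [← ENNReal.ofReal_toReal htop, EReal.coe_ennreal_ofReal,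
      max_eq_left ENNReal.toReal_nonneg, ← EReal.coe_sub, EReal.coe_lt_coe_iff] at hs
    exact hs

theorem le_conjugateReal (hψ : IsDivergenceFunction ψ) (hc : HasSmoothConjugate M ψ) (t : ℝ) :
    t ≤ conjugateReal ψ t := by
  simpa [hψ.one] using mul_sub_toReal_le_conjugateReal hc (s := 1) (by simp [hψ.one]) t

theorem conjugateReal_zero (hψ : IsDivergenceFunction ψ) (hc : HasSmoothConjugate M ψ) :
    conjugateReal ψ 0 = 0 := by
  refine le_antisymm ?_ (le_conjugateReal hψ hc 0)
  refine le_of_forall_pos_le_add fun δ hδ => ?_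
  obtain ⟨s, -, -, hs⟩ := exists_lt_mul_sub_toReal hψ hc 0 hδ
  have := ENNReal.toReal_nonneg (a := ψ s)
  linarith

theorem monotone_conjugateReal (hψ : IsDivergenceFunction ψ) (hc : HasSmoothConjugate M ψ) :
    Monotone (conjugateReal ψ) := by
  intro t u htu
  refine le_of_forall_pos_le_add fun δ hδ => ?_
  obtain ⟨s, hs0, htop, hs⟩ := exists_lt_mul_sub_toReal hψ hc t hδ
  have := mul_sub_toReal_le_conjugateReal hc htop u
  have := mul_le_mul_of_nonneg_left htu hs0
  linarith

theorem convexOn_conjugateReal (hψ : IsDivergenceFunction ψ) (hc : HasSmoothConjugate M ψ) :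
    ConvexOn ℝ Set.univ (conjugateReal ψ) := by
  refine ⟨convex_univ, fun t _ u _ a b ha hb hab => ?_⟩
  simp only [smul_eq_mul]
  refine le_of_forall_pos_le_add fun δ hδ => ?_
  obtain ⟨s, hs0, htop, hs⟩ := exists_lt_mul_sub_toReal hψ hc (a * t + b * u) hδ
  have h1 := mul_le_mul_of_nonneg_left (mul_sub_toReal_le_conjugateReal hc htop t) ha
  have h2 := mul_le_mul_of_nonneg_left (mul_sub_toReal_le_conjugateReal hc htop u) hb
  have : (ψ s).toReal = a * (ψ s).toReal + b * (ψ s).toReal := by rw [← add_mul, hab, one_mul]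
  nlinarith

theorem differentiable_conjugateReal (hc : HasSmoothConjugate M ψ) :
    Differentiable ℝ (conjugateReal ψ) := hc.2.1

theorem monotone_deriv_conjugateReal (hψ : IsDivergenceFunction ψ)
    (hc : HasSmoothConjugate M ψ) : Monotone (deriv (conjugateReal ψ)) := by
  rw [← monotoneOn_univ]
  exact (convexOn_conjugateReal hψ hc).monotoneOn_deriv
    fun x _ => differentiable_conjugateReal hc x

theorem deriv_conjugateReal_nonneg (hψ : IsDivergenceFunction ψ) (hc : HasSmoothConjugate M ψ)
    (t : ℝ) : 0 ≤ deriv (conjugateReal ψ) t :=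
  (monotone_conjugateReal hψ hc).deriv_nonneg

theorem abs_deriv_conjugateReal_sub_le (hc : HasSmoothConjugate M ψ) (s t : ℝ) :
    |deriv (conjugateReal ψ) s - deriv (conjugateReal ψ) t| ≤ M * |s - t| := by
  simpa [gradient_eq_deriv', Real.norm_eq_abs] using hc.2.2 s t

theorem continuous_deriv_conjugateReal (hc : HasSmoothConjugate M ψ) :
    Continuous (deriv (conjugateReal ψ)) :=
  (LipschitzWith.of_dist_le' (K := M) fun s t => by
    simpa [Real.dist_eq] using abs_deriv_conjugateReal_sub_le hc s t).continuous

theorem abs_conjugateReal_sub_le (hM : 0 ≤ M) (hc : HasSmoothConjugate M ψ) (s t : ℝ) :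
    |conjugateReal ψ s - conjugateReal ψ t - deriv (conjugateReal ψ) t * (s - t)|
      ≤ M * (s - t) ^ 2 := by
  have := abs_sub_sub_inner_le (f := conjugateReal ψ) (x := t) (y := s) hc.2.1 hM
    (fun z => hc.2.2 z t)
  rw [gradient_eq_deriv'] at this
  simpa [mul_comm] using this

/-- The function φ(t) - t is nonnegative and vanishes at 0. This normalisation is what ties the
weights φ' to the density 1. -/
theorem deriv_conjugateReal_zero (hψ : IsDivergenceFunction ψ) (hc : HasSmoothConjugate M ψ) :
    deriv (conjugateReal ψ) 0 = 1 := by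
  have hmin : IsLocalMin (fun t => conjugateReal ψ t - t) 0 := by
    refine Filter.Eventually.of_forall fun t => ?_
    simp only [conjugateReal_zero hψ hc]
    linarith [le_conjugateReal hψ hc t]
  have hd : HasDerivAt (fun t => conjugateReal ψ t - t) (deriv (conjugateReal ψ) 0 - 1) 0 :=
    ((differentiable_conjugateReal hc 0).hasDerivAt).sub (hasDerivAt_id 0)
  linarith [hmin.hasDerivAt_eq_zero hd]

theorem abs_conjugateReal_sub_self_le (hM : 0 ≤ M) (hψ : IsDivergenceFunction ψ)
    (hc : HasSmoothConjugate M ψ) (t : ℝ) : |conjugateReal ψ t - t| ≤ M * t ^ 2 := by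
  simpa [conjugateReal_zero hψ hc, deriv_conjugateReal_zero hψ hc] using
    abs_conjugateReal_sub_le hM hc t 0

theorem abs_deriv_conjugateReal_sub_one_le (hψ : IsDivergenceFunction ψ)
    (hc : HasSmoothConjugate M ψ) (t : ℝ) : |deriv (conjugateReal ψ) t - 1| ≤ M * |t| := by
  simpa [deriv_conjugateReal_zero hψ hc] using abs_deriv_conjugateReal_sub_le hc t 0

/-- Along the ray r ↦ r t the function φ(r t) - r t starts at 0, is nonincreasing by the sign
condition and is always nonnegative. The condition holds for t ≥ 0 if φ' ≤ 1 everywhere, and for t ≤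
0 if φ' ≥ 1 everywhere. -/
theorem conjugateReal_neg_eq (hψ : IsDivergenceFunction ψ) (hc : HasSmoothConjugate M ψ)
    {t : ℝ} (h : ∀ u, 0 ≤ (deriv (conjugateReal ψ) u - 1) * -t) : conjugateReal ψ t = t := by
  refine le_antisymm ?_ (le_conjugateReal hψ hc t)
  have hd : ∀ r, HasDerivAt (fun r => conjugateReal ψ (r * t) - r * t)
      (deriv (conjugateReal ψ) (r * t) * t - t) r := fun r => by
    have h1 : HasDerivAt (fun r : ℝ => r * t) t r := by
      simpa using (hasDerivAt_id r).mul_const t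
    exact ((differentiable_conjugateReal hc (r * t)).hasDerivAt.comp r h1).sub h1
  have hanti : Antitone fun r : ℝ => conjugateReal ψ (r * t) - r * t := by
    refine antitone_of_deriv_nonpos (fun r => (hd r).differentiableAt) fun r => ?_
    rw [(hd r).deriv]
    have := h (r * t)
    linarith
  have := hanti zero_le_one
  simp [conjugateReal_zero hψ hc] at this
  linarith

/-- Convexity and φ(0) = 0. The difference of the two sides is the divergence integrand of the
density φ'(t), so this is its nonnegativity. -/
theorem conjugateReal_le_deriv_mul_self (hψ : IsDivergenceFunction ψ)
    (hc : HasSmoothConjugate M ψ) (t : ℝ) :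
    conjugateReal ψ t ≤ deriv (conjugateReal ψ) t * t := by
  have h := convexOn_conjugateReal hψ hc
  have h0 := conjugateReal_zero hψ hc
  rcases lt_trichotomy t 0 with ht | rfl | ht
  · have := h.deriv_le_slope (Set.mem_univ _) (Set.mem_univ _) ht
      (differentiable_conjugateReal hc t)
    rw [slope_def_field, h0, le_div_iff₀ (by linarith)] at this
    linarith
  · simp [h0]
  · have := h.slope_le_deriv (Set.mem_univ _) (Set.mem_univ _) ht
      (differentiable_conjugateReal hc t)
    rw [slope_def_field, h0, div_le_iff₀ (by linarith)] at this
    linarith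

/-- A near-maximiser s of s t - ψ(s) gives an affine minorant of φ that is within ρ² of φ at t.
Comparing it with the quadratic upper bound at t ± ρ pins its slope to φ'(t). -/
theorem exists_abs_sub_deriv_le (hM : 0 ≤ M) (hψ : IsDivergenceFunction ψ)
    (hc : HasSmoothConjugate M ψ) (t : ℝ) {ρ : ℝ} (hρ : 0 < ρ) :
    ∃ s, ψ s ≠ ⊤ ∧ conjugateReal ψ t - ρ ^ 2 < s * t - (ψ s).toReal ∧
      |s - deriv (conjugateReal ψ) t| ≤ (1 + M) * ρ := by
  obtain ⟨s, -, htop, hs⟩ := exists_lt_mul_sub_toReal hψ hc t (pow_pos hρ 2)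
  refine ⟨s, htop, hs, ?_⟩
  have key : ∀ h, (s - deriv (conjugateReal ψ) t) * h ≤ ρ ^ 2 + M * h ^ 2 := fun h => by
    have h1 := mul_sub_toReal_le_conjugateReal hc htop (t + h)
    have h2 := (abs_le.1 (abs_conjugateReal_sub_le hM hc (t + h) t)).2
    simp only [add_sub_cancel_left] at h2
    linarith
  rw [abs_le]
  constructor
  · have := key (-ρ)
    by_contra! h0
    nlinarith
  · have := key ρ
    by_contra! h0
    nlinarith

/-- Where a maximiser `y` of `s t - ψ s` may lie on the boundary of the domain, points between
`y` and `1` still satisfy the bound that convexity would give. -/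
theorem psi_lineMap_deriv_le (hM : 0 ≤ M) (hψ : IsDivergenceFunction ψ)
    (hc : HasSmoothConjugate M ψ) (t : ℝ) {θ : ℝ} (h0 : 0 < θ) (h1 : θ < 1) :
    ψ ((1 - θ) * deriv (conjugateReal ψ) t + θ) ≤
      ENNReal.ofReal ((1 - θ) * (deriv (conjugateReal ψ) t * t - conjugateReal ψ t)) := by
  set y := deriv (conjugateReal ψ) t with hy
  rcases eq_or_ne y 1 with h | h
  · rw [h]; simp [hψ.one]
  have hsub : y - 1 ≠ 0 := sub_ne_zero.2 h
  -- Near-maximisers `s n` tend to `y`, but ψ need not be lower semicontinuous at `y`. The bound is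
  -- therefore proved at one fixed point between `y` and 1, written as a varying combination of `s
  -- n` and 1.
  choose s htop hs hsy using fun n : ℕ =>
    exists_abs_sub_deriv_le hM hψ hc t (ρ := 1 / ((n : ℝ) + 1)) (by positivity)
  have hlim : Filter.Tendsto (fun n : ℕ => 1 / ((n : ℝ) + 1)) Filter.atTop (nhds 0) :=
    tendsto_one_div_add_atTop_nhds_zero_nat
  have hslim : Filter.Tendsto s Filter.atTop (nhds y) := by
    rw [tendsto_iff_dist_tendsto_zero]
    refine squeeze_zero (fun _ => dist_nonneg) (fun n => hsy n) ?_
    simpa using hlim.const_mul (1 + M)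
  have halim : Filter.Tendsto (fun n => (1 - θ) * (y - 1) / (s n - 1)) Filter.atTop
      (nhds (1 - θ)) := by
    have := (tendsto_const_nhds (x := (1 - θ) * (y - 1))).div (hslim.sub_const 1) hsub
    rwa [mul_div_cancel_right₀ _ hsub] at this
  have hR : Filter.Tendsto (fun n => ENNReal.ofReal ((1 - θ) * (y - 1) / (s n - 1) *
      (s n * t - conjugateReal ψ t + (1 / ((n : ℝ) + 1)) ^ 2))) Filter.atTop
      (nhds (ENNReal.ofReal ((1 - θ) * (y * t - conjugateReal ψ t)))) := by
    refine (ENNReal.continuous_ofReal.tendsto _).comp (halim.mul ?_)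
    have := ((hslim.mul_const t).sub_const (conjugateReal ψ t)).add (hlim.pow 2)
    simpa using this
  refine ge_of_tendsto hR ?_
  have hne : ∀ᶠ n in Filter.atTop, s n - 1 ≠ 0 :=
    (hslim.sub_const 1).eventually_ne hsub
  filter_upwards [halim.eventually (lt_mem_nhds (show 0 < 1 - θ by linarith)),
    halim.eventually (gt_mem_nhds (show 1 - θ < 1 by linarith)), hne] with n hn0 hn1 hn2
  -- This coefficient makes a·s n + (1 - a)·1 equal to (1 - θ)y + θ for every n. The point 1 costs
  -- nothing, as ψ(1) = 0.
  set a := (1 - θ) * (y - 1) / (s n - 1) with ha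
  have e : (1 - θ) * y + θ = a * s n + (1 - a) * 1 := by
    have : a * (s n - 1) = (1 - θ) * (y - 1) := div_mul_cancel₀ _ hn2
    linarith
  rw [e]
  refine (hψ.convex _ _ a (1 - a) hn0.le (by linarith) (by ring)).trans ?_
  rw [hψ.one, mul_zero, add_zero, ENNReal.ofReal_mul hn0.le]
  gcongr
  rw [← ENNReal.ofReal_toReal (htop n)]
  refine ENNReal.ofReal_le_ofReal ?_
  have := hs n
  linarith

end Conjugate
end DRO

/-! ### Pointwise and integrated expansions of the loss and of the dual. -/

namespace DRO

/-- The standing assumptions on a penalized DRO problem. -/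
structure IsDROProblem {Ξ : Type*} [MeasurableSpace Ξ] {d : ℕ} (G L M σ lam : ℝ) (P : Measure Ξ)
    (loss : Param d → Ξ → ℝ) (ψ : ℝ → ℝ≥0∞) : Prop where
  G_nonneg : 0 ≤ G
  L_nonneg : 0 ≤ L
  M_nonneg : 0 ≤ M
  lam_pos : 0 < lam
  lipschitzSmooth : IsLipschitzSmoothLoss G L loss
  divergence : IsDivergenceFunction ψ
  conj : HasSmoothConjugate M ψ
  variance : HasVarianceBound σ P loss

section Dual

variable {Ξ : Type*} {d : ℕ}

/-- The gradient of the loss in the decision variable. -/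
noncomputable def lossGrad (loss : Param d → Ξ → ℝ) (x : Param d) (ξ : Ξ) : Param d :=
  gradient (fun y => loss y ξ) x

/-- The weight `ψ*'((loss(x, ξ) - c) / lam)` that the dual variable `c` gives to a sample. -/
noncomputable def weight (loss : Param d → Ξ → ℝ) (ψ : ℝ → ℝ≥0∞) (lam : ℝ) (x : Param d) (c : ℝ)
    (ξ : Ξ) : ℝ :=
  deriv (conjugateReal ψ) ((loss x ξ - c) / lam)

/-- The dual objective at one sample, with an unscaled dual variable. -/
noncomputable def dualSample (loss : Param d → Ξ → ℝ) (ψ : ℝ → ℝ≥0∞) (lam : ℝ) (x : Param d)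
    (c : ℝ) (ξ : Ξ) : ℝ :=
  lam * conjugateReal ψ ((loss x ξ - c) / lam) + c

variable [MeasurableSpace Ξ] {G L M σ lam : ℝ} {P : Measure Ξ}
  {loss : Param d → Ξ → ℝ} {ψ : ℝ → ℝ≥0∞}

namespace IsDROProblem

variable (h : IsDROProblem G L M σ lam P loss ψ)
include h

theorem hasGradientAt_loss (x : Param d) (ξ : Ξ) :
    HasGradientAt (fun y => loss y ξ) (lossGrad loss x ξ) x :=
  ((h.lipschitzSmooth.smooth ξ).1 x).hasGradientAt

theorem norm_lossGrad_le (x : Param d) (ξ : Ξ) : ‖lossGrad loss x ξ‖ ≤ G := by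
  have h1 : LipschitzWith ⟨G, h.G_nonneg⟩ (fun y => loss y ξ) :=
    LipschitzWith.of_dist_le_mul fun y z => by
      rw [Real.dist_eq, dist_eq_norm]; exact h.lipschitzSmooth.lipschitz ξ y z
  have h2 := norm_fderiv_le_of_lipschitz ℝ h1 (x₀ := x)
  rwa [← toDual_gradient, LinearIsometryEquiv.norm_map] at h2

theorem norm_lossGrad_sub_le (x y : Param d) (ξ : Ξ) :
    ‖lossGrad loss x ξ - lossGrad loss y ξ‖ ≤ L * ‖x - y‖ :=
  (h.lipschitzSmooth.smooth ξ).2 x y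

theorem abs_loss_sub_sub_inner_le (x y : Param d) (ξ : Ξ) :
    |loss y ξ - loss x ξ - inner ℝ (lossGrad loss x ξ) (y - x)| ≤ L * ‖y - x‖ ^ 2 :=
  abs_sub_sub_inner_le (h.lipschitzSmooth.smooth ξ).1 h.L_nonneg
    fun z => (h.lipschitzSmooth.smooth ξ).2 z x

/-- Each directional derivative is a pointwise limit of difference quotients, which are measurable
in ξ; the coordinates then give the gradient. -/
theorem measurable_lossGrad (x : Param d) : Measurable (lossGrad loss x) := by
  have hcoef : ∀ v : Param d, Measurable fun ξ => inner ℝ (lossGrad loss x ξ) v := fun v => by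
    refine measurable_of_tendsto_metrizable
      (f := fun (n : ℕ) ξ => (n : ℝ) • (loss (x + (n : ℝ)⁻¹ • v) ξ - loss x ξ)) (fun n => ?_) ?_
    · exact ((h.variance.measurable _).sub (h.variance.measurable _)).const_mul (n : ℝ)
    · rw [tendsto_pi_nhds]
      intro ξ
      exact ((h.hasGradientAt_loss x ξ).hasFDerivAt.lim_real v).comp tendsto_natCast_atTop_atTop
  have e : lossGrad loss x = fun ξ => ∑ i, inner ℝ (lossGrad loss x ξ)
      (EuclideanSpace.basisFun (Fin d) ℝ i) • EuclideanSpace.basisFun (Fin d) ℝ i := by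
    funext ξ
    conv_lhs => rw [← (EuclideanSpace.basisFun (Fin d) ℝ).sum_repr' (lossGrad loss x ξ)]
    simp [real_inner_comm]
  rw [e]
  exact Finset.measurable_fun_sum _ fun i _ => (hcoef _).smul_const _

theorem measurable_weight (x : Param d) (c : ℝ) : Measurable (weight loss ψ lam x c) :=
  (continuous_deriv_conjugateReal h.conj).measurable.comp
    (((h.variance.measurable x).sub_const c).div_const lam)

theorem weight_nonneg (x : Param d) (c : ℝ) (ξ : Ξ) : 0 ≤ weight loss ψ lam x c ξ :=
  deriv_conjugateReal_nonneg h.divergence h.conj _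

theorem abs_weight_sub_le (x y : Param d) (c c' : ℝ) (ξ : Ξ) :
    |weight loss ψ lam x c ξ - weight loss ψ lam y c' ξ|
      ≤ M / lam * |(loss x ξ - loss y ξ) - (c - c')| := by
  refine (abs_deriv_conjugateReal_sub_le h.conj _ _).trans (le_of_eq ?_)
  rw [← sub_div, abs_div, abs_of_pos h.lam_pos]
  have : loss x ξ - c - (loss y ξ - c') = (loss x ξ - loss y ξ) - (c - c') := by ring
  rw [this]; ring

/-- The quadratic error bound for φ, rescaled: λ · M/λ² = M/λ. -/
theorem abs_dualSample_sub_le (x y : Param d) (c c' : ℝ) (ξ : Ξ) :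
    |dualSample loss ψ lam y c' ξ - dualSample loss ψ lam x c ξ
      - (weight loss ψ lam x c ξ * (loss y ξ - loss x ξ)
        + (1 - weight loss ψ lam x c ξ) * (c' - c))|
      ≤ M / lam * ((loss y ξ - loss x ξ) - (c' - c)) ^ 2 := by
  have h1 := abs_conjugateReal_sub_le h.M_nonneg h.conj ((loss y ξ - c') / lam)
    ((loss x ξ - c) / lam)
  have hl := h.lam_pos
  have e : dualSample loss ψ lam y c' ξ - dualSample loss ψ lam x c ξ
      - (weight loss ψ lam x c ξ * (loss y ξ - loss x ξ)
        + (1 - weight loss ψ lam x c ξ) * (c' - c)) = lam *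
      (conjugateReal ψ ((loss y ξ - c') / lam) - conjugateReal ψ ((loss x ξ - c) / lam)
        - deriv (conjugateReal ψ) ((loss x ξ - c) / lam)
          * ((loss y ξ - c') / lam - (loss x ξ - c) / lam)) := by
    simp only [dualSample, weight]
    field_simp
    ring
  rw [e, abs_mul, abs_of_pos hl]
  refine (mul_le_mul_of_nonneg_left h1 hl.le).trans (le_of_eq ?_)
  field_simp
  ring

theorem integrable_smul_lossGrad {q : Ξ → ℝ} (hq : Integrable q P) (x : Param d) :
    Integrable (fun ξ => q ξ • lossGrad loss x ξ) P := by
  refine (hq.norm.mul_const G).mono'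
    (hq.1.smul (h.measurable_lossGrad x).aestronglyMeasurable)
    (Filter.Eventually.of_forall fun ξ => ?_)
  rw [norm_smul]
  exact mul_le_mul_of_nonneg_left (h.norm_lossGrad_le x ξ) (norm_nonneg _)

variable [IsProbabilityMeasure P]

theorem memLp_loss (x : Param d) : MemLp (loss x) 2 P := by
  rw [← evariance_lt_top_iff_memLp (h.variance.measurable x).aestronglyMeasurable]
  exact (h.variance.variance_le x).trans_lt ENNReal.ofReal_lt_top

theorem memLp_scaled_loss (x : Param d) (c : ℝ) : MemLp (fun ξ => (loss x ξ - c) / lam) 2 P := by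
  simpa [div_eq_inv_mul] using ((h.memLp_loss x).sub (memLp_const c)).const_mul lam⁻¹

/-- The derivative φ' grows at most linearly, |φ'(t) - 1| ≤ M|t|, and the loss is square integrable
because its variance is finite. -/
theorem memLp_weight (x : Param d) (c : ℝ) : MemLp (weight loss ψ lam x c) 2 P := by
  have h1 : MemLp (fun ξ => weight loss ψ lam x c ξ - 1) 2 P := by
    refine (h.memLp_scaled_loss x c).of_le_mul (c := M)
      ((h.measurable_weight x c).sub_const 1).aestronglyMeasurable
      (Filter.Eventually.of_forall fun ξ => ?_)
    exact abs_deriv_conjugateReal_sub_one_le h.divergence h.conj _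
  have h2 := h1.add (memLp_const (1 : ℝ))
  exact h2.congr_norm (h.measurable_weight x c).aestronglyMeasurable (by simp)

theorem integrable_weight (x : Param d) (c : ℝ) : Integrable (weight loss ψ lam x c) P :=
  (h.memLp_weight x c).integrable one_le_two

theorem integrable_conjugate {f : Ξ → ℝ} (hf : MemLp f 2 P) :
    Integrable (fun ξ => conjugateReal ψ (f ξ)) P := by
  have h1 : Integrable (fun ξ => conjugateReal ψ (f ξ) - f ξ) P := by
    refine (hf.integrable_sq.const_mul M).mono'
      (((differentiable_conjugateReal h.conj).continuous.comp_aestronglyMeasurable hf.1).sub hf.1)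
      (Filter.Eventually.of_forall fun ξ => ?_)
    exact abs_conjugateReal_sub_self_le h.M_nonneg h.divergence h.conj _
  exact (h1.add (hf.integrable one_le_two)).congr (by simp [Filter.EventuallyEq])

theorem integrable_dualSample (x : Param d) (c : ℝ) :
    Integrable (dualSample loss ψ lam x c) P :=
  ((h.integrable_conjugate (h.memLp_scaled_loss x c)).const_mul lam).add (integrable_const c)

theorem integrable_weight_mul_loss (x y : Param d) (c : ℝ) :
    Integrable (fun ξ => weight loss ψ lam x c ξ * loss y ξ) P :=
  (h.memLp_weight x c).integrable_mul (h.memLp_loss y)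

theorem integral_loss_sub_sub_inner_le {q : Ξ → ℝ} (hq : MemLp q 2 P) (hq0 : ∀ ξ, 0 ≤ q ξ)
    (x y : Param d) :
    |∫ ξ, q ξ * (loss y ξ - loss x ξ) ∂P
      - inner ℝ (∫ ξ, q ξ • lossGrad loss x ξ ∂P) (y - x)| ≤ L * (∫ ξ, q ξ ∂P) * ‖y - x‖ ^ 2 := by
  have hq1 := hq.integrable one_le_two
  have hg := h.integrable_smul_lossGrad hq1 x
  have hl : Integrable (fun ξ => q ξ * (loss y ξ - loss x ξ)) P :=
    hq.integrable_mul ((h.memLp_loss y).sub (h.memLp_loss x))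
  have hq' : |∫ ξ, q ξ * (loss y ξ - loss x ξ) - inner ℝ (y - x) (q ξ • lossGrad loss x ξ) ∂P|
      ≤ ∫ ξ, q ξ * (L * ‖y - x‖ ^ 2) ∂P := by
    rw [← Real.norm_eq_abs]
    refine norm_integral_le_of_norm_le (hq1.mul_const _) (Filter.Eventually.of_forall fun ξ => ?_)
    rw [real_inner_comm, real_inner_smul_left, ← mul_sub, norm_mul, Real.norm_of_nonneg (hq0 ξ)]
    exact mul_le_mul_of_nonneg_left (h.abs_loss_sub_sub_inner_le x y ξ) (hq0 ξ)
  rw [integral_sub hl (hg.const_inner (y - x)), integral_inner hg, integral_mul_const] at hq'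
  rw [real_inner_comm]
  linarith

end IsDROProblem
end Dual
end DRO

/-! ### Finiteness, weak duality and lower bounds for the penalized objective. -/

namespace DRO

section Primal

variable {Ξ : Type*} {d : ℕ} [MeasurableSpace Ξ] {G L M σ lam : ℝ} {P : Measure Ξ}
  {loss : Param d → Ξ → ℝ} {ψ : ℝ → ℝ≥0∞}

theorem integral_rnDeriv_toReal_eq_one [IsProbabilityMeasure P] {Q : Measure Ξ}
    [IsProbabilityMeasure Q]
    (hQP : Q ≪ P) : ∫ ξ, (Q.rnDeriv P ξ).toReal ∂P = 1 := by
  have := integral_rnDeriv_smul (f := fun _ => (1 : ℝ)) hQP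
  simpa using this

namespace IsDROProblem

variable (h : IsDROProblem G L M σ lam P loss ψ)
include h

theorem penalizedObjective_le_of_forall {y : Param d} {B : ℝ}
    (hB : ∀ Q : Measure Ξ, IsProbabilityMeasure Q → Q ≪ P → psiDivergence ψ Q P ≠ ⊤ →
      ∫ ξ, loss y ξ ∂Q - lam * (psiDivergence ψ Q P).toReal ≤ B) :
    penalizedObjective loss ψ lam P y ≤ B := by
  refine iSup_le fun Q => iSup_le fun hQ => iSup_le fun hQP => ?_
  by_cases hd : psiDivergence ψ Q P = ⊤
  · rw [hd, EReal.coe_ennreal_top, EReal.coe_mul_top_of_pos h.lam_pos, EReal.sub_top]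
    exact bot_le
  · rw [← ENNReal.ofReal_toReal hd, EReal.coe_ennreal_ofReal,
      max_eq_left ENNReal.toReal_nonneg, ← EReal.coe_mul, ← EReal.coe_sub, EReal.coe_le_coe_iff]
    exact hB Q hQ hQP hd

variable [IsProbabilityMeasure P]

/-- The integrated Fenchel-Young inequality. -/
theorem integral_mul_sub_le_psiDivergence {Q : Measure Ξ} [IsProbabilityMeasure Q]
    (hd : psiDivergence ψ Q P ≠ ⊤) {t : Ξ → ℝ} (ht : MemLp t 2 P) :
    Integrable (fun ξ => (Q.rnDeriv P ξ).toReal * t ξ) P ∧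
    ∫ ξ, (Q.rnDeriv P ξ).toReal * t ξ ∂P - ∫ ξ, conjugateReal ψ (t ξ) ∂P
      ≤ (psiDivergence ψ Q P).toReal := by
  set q : Ξ → ℝ := fun ξ => (Q.rnDeriv P ξ).toReal with hq
  have hqm : Measurable q := (Measure.measurable_rnDeriv Q P).ennreal_toReal
  have hφc := (differentiable_conjugateReal h.conj).continuous
  have pos : ∀ {u : Ξ → ℝ}, MemLp u 2 P →
      Integrable (fun ξ => max (q ξ * u ξ - conjugateReal ψ (u ξ)) 0) P := fun {u} hu => by
    have hm : AEStronglyMeasurable (fun ξ => q ξ * u ξ - conjugateReal ψ (u ξ)) P :=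
      (hqm.aestronglyMeasurable.mul hu.1).sub (hφc.comp_aestronglyMeasurable hu.1)
    refine ⟨hm.sup aestronglyMeasurable_const, ?_⟩
    rw [hasFiniteIntegral_iff_ofReal (f := fun ξ => max (q ξ * u ξ - conjugateReal ψ (u ξ)) 0)
      (Filter.Eventually.of_forall fun ξ => le_max_right _ _)]
    refine lt_of_le_of_lt (lintegral_mono fun ξ => ?_) (lt_top_iff_ne_top.2 hd)
    rw [ENNReal.ofReal_max, ENNReal.ofReal_zero, max_eq_left zero_le]
    exact ofReal_mul_sub_conjugateReal_le h.conj _ _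
  -- Integrability of q t is not assumed: q|t| is at most φ(|t|) plus the positive part of q|t| -
  -- φ(|t|), and the latter is dominated by ψ(q), of finite integral.
  have hint : Integrable (fun ξ => q ξ * t ξ) P := by
    have ht' : MemLp (fun ξ => |t ξ|) 2 P := ht.norm
    refine ((pos ht').add (h.integrable_conjugate ht')).mono'
      (hqm.aestronglyMeasurable.mul ht.1) (Filter.Eventually.of_forall fun ξ => ?_)
    rw [norm_mul, Real.norm_of_nonneg (show 0 ≤ q ξ from ENNReal.toReal_nonneg), Real.norm_eq_abs]
    have := le_max_left (q ξ * |t ξ| - conjugateReal ψ |t ξ|) 0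
    simp only [Pi.add_apply]
    linarith
  refine ⟨hint, ?_⟩
  have hφ := h.integrable_conjugate ht
  rw [← integral_sub hint hφ]
  calc _ ≤ ∫ ξ, max (q ξ * t ξ - conjugateReal ψ (t ξ)) 0 ∂P :=
        integral_mono (hint.sub hφ) (pos ht) fun ξ => le_max_left _ _
    _ = (∫⁻ ξ, ENNReal.ofReal (max (q ξ * t ξ - conjugateReal ψ (t ξ)) 0) ∂P).toReal :=
        integral_eq_lintegral_of_nonneg_ae (Filter.Eventually.of_forall fun ξ => le_max_right _ _)
          (pos ht).1
    _ ≤ _ := by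
        refine ENNReal.toReal_mono hd (lintegral_mono fun ξ => ?_)
        rw [ENNReal.ofReal_max, ENNReal.ofReal_zero, max_eq_left zero_le]
        exact ofReal_mul_sub_conjugateReal_le h.conj _ _

/-- Weak duality. -/
theorem penalizedObjective_le (y : Param d) (c : ℝ) :
    penalizedObjective loss ψ lam P y ≤ ((∫ ξ, dualSample loss ψ lam y c ξ ∂P : ℝ) : EReal) := by
  refine h.penalizedObjective_le_of_forall fun Q _ hQP hd => ?_
  obtain ⟨hint, hle⟩ := h.integral_mul_sub_le_psiDivergence hd (h.memLp_scaled_loss y c)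
  have hone := integral_rnDeriv_toReal_eq_one hQP
  have hqi : Integrable (fun ξ => (Q.rnDeriv P ξ).toReal) P := Measure.integrable_toReal_rnDeriv
  have hl := h.lam_pos
  have e1 : ∫ ξ, loss y ξ ∂Q
      = lam * ∫ ξ, (Q.rnDeriv P ξ).toReal * ((loss y ξ - c) / lam) ∂P + c := by
    rw [← integral_rnDeriv_smul hQP, ← integral_const_mul]
    nth_rewrite 2 [← mul_one c]
    rw [← hone, ← integral_const_mul, ← integral_add (hint.const_mul lam) (hqi.const_mul c)]
    refine integral_congr_ae (Filter.Eventually.of_forall fun ξ => ?_)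
    simp only [smul_eq_mul]
    field_simp
    ring
  have e2 : ∫ ξ, dualSample loss ψ lam y c ξ ∂P
      = lam * ∫ ξ, conjugateReal ψ ((loss y ξ - c) / lam) ∂P + c := by
    simp only [dualSample]
    rw [integral_add ((h.integrable_conjugate (h.memLp_scaled_loss y c)).const_mul lam)
      (integrable_const c), integral_const_mul]
    simp
  rw [e1, e2]
  have := mul_le_mul_of_nonneg_left hle hl.le
  linarith

theorem integral_loss_le_penalizedObjective (y : Param d) :
    ((∫ ξ, loss y ξ ∂P : ℝ) : EReal) ≤ penalizedObjective loss ψ lam P y := by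
  have h0 : psiDivergence ψ P P = 0 := by
    rw [psiDivergence, lintegral_congr_ae (g := fun _ => 0)]
    · simp
    · filter_upwards [Measure.rnDeriv_self P] with ξ hξ
      simp [hξ, h.divergence.one]
  refine le_trans ?_ (le_iSup_of_le P (le_iSup_of_le inferInstance
    (le_iSup_of_le Measure.AbsolutelyContinuous.rfl le_rfl)))
  simp [h0]

theorem penalizedObjective_ne (y : Param d) :
    penalizedObjective loss ψ lam P y ≠ ⊥ ∧ penalizedObjective loss ψ lam P y ≠ ⊤ :=
  ⟨fun h0 => by simpa [h0] using h.integral_loss_le_penalizedObjective y,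
    fun h0 => by simpa [h0] using h.penalizedObjective_le y 0⟩

theorem coe_penalizedObjectiveReal (y : Param d) :
    ((penalizedObjectiveReal loss ψ lam P y : ℝ) : EReal) = penalizedObjective loss ψ lam P y :=
  EReal.coe_toReal (h.penalizedObjective_ne y).2 (h.penalizedObjective_ne y).1

theorem penalizedObjectiveReal_le (y : Param d) (c : ℝ) :
    penalizedObjectiveReal loss ψ lam P y ≤ ∫ ξ, dualSample loss ψ lam y c ξ ∂P := by
  have := h.penalizedObjective_le y c
  rwa [← h.coe_penalizedObjectiveReal, EReal.coe_le_coe_iff] at this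

/-- The density φ'∘t itself may have values where ψ exceeds its lower semicontinuous hull. Mixing it
with P in proportion θ avoids this, and `psi_lineMap_deriv_le` bounds the divergence of the mixture
by 1 - θ times the expected one. -/
theorem lineMap_le_penalizedObjectiveReal {t : Ξ → ℝ} (ht : Measurable t) (ht2 : MemLp t 2 P)
    (hone : ∫ ξ, deriv (conjugateReal ψ) (t ξ) ∂P = 1)
    (hq : MemLp (fun ξ => deriv (conjugateReal ψ) (t ξ)) 2 P) (y : Param d) {θ : ℝ}
    (h0 : 0 < θ) (h1 : θ < 1) :
    (1 - θ) * (∫ ξ, deriv (conjugateReal ψ) (t ξ) * loss y ξ ∂P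
      - lam * ∫ ξ, (deriv (conjugateReal ψ) (t ξ) * t ξ - conjugateReal ψ (t ξ)) ∂P)
      + θ * ∫ ξ, loss y ξ ∂P ≤ penalizedObjectiveReal loss ψ lam P y := by
  set q : Ξ → ℝ := fun ξ => deriv (conjugateReal ψ) (t ξ) with hqdef
  have hqm : Measurable q := (continuous_deriv_conjugateReal h.conj).measurable.comp ht
  have hq0 : ∀ ξ, 0 ≤ q ξ := fun ξ => deriv_conjugateReal_nonneg h.divergence h.conj _
  have hqi := hq.integrable one_le_two
  set r : Ξ → ℝ := fun ξ => (1 - θ) * q ξ + θ with hr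
  have hrm : Measurable r := (hqm.const_mul _).add_const _
  have hr0 : ∀ ξ, 0 ≤ r ξ := fun ξ =>
    add_nonneg (mul_nonneg (by linarith) (hq0 ξ)) h0.le
  have hri : Integrable r P := (hqi.const_mul _).add (integrable_const _)
  have hrone : ∫ ξ, r ξ ∂P = 1 := by
    rw [hr, integral_add (hqi.const_mul _) (integrable_const _), integral_const_mul, hone]
    simp
  set Q : Measure Ξ := P.withDensity fun ξ => ENNReal.ofReal (r ξ) with hQ
  have hQprob : IsProbabilityMeasure Q := ⟨by
    rw [hQ, withDensity_apply _ MeasurableSet.univ, Measure.restrict_univ,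
      ← ofReal_integral_eq_lintegral_ofReal hri (Filter.Eventually.of_forall hr0), hrone,
      ENNReal.ofReal_one]⟩
  have hQP : Q ≪ P := withDensity_absolutelyContinuous _ _
  have hrn : Q.rnDeriv P =ᵐ[P] fun ξ => ENNReal.ofReal (r ξ) :=
    Measure.rnDeriv_withDensity P hrm.ennreal_ofReal
  set D : ℝ := ∫ ξ, (q ξ * t ξ - conjugateReal ψ (t ξ)) ∂P with hD
  have hDi : Integrable (fun ξ => q ξ * t ξ - conjugateReal ψ (t ξ)) P :=
    (hq.integrable_mul ht2).sub (h.integrable_conjugate ht2)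
  have hD0 : ∀ ξ, 0 ≤ q ξ * t ξ - conjugateReal ψ (t ξ) := fun ξ =>
    sub_nonneg.2 (conjugateReal_le_deriv_mul_self h.divergence h.conj _)
  have hdiv : psiDivergence ψ Q P ≤ ENNReal.ofReal ((1 - θ) * D) := by
    rw [hD, ← integral_const_mul, ofReal_integral_eq_lintegral_ofReal (hDi.const_mul _)
      (Filter.Eventually.of_forall fun ξ => mul_nonneg (by linarith) (hD0 ξ))]
    refine lintegral_mono_ae ?_
    filter_upwards [hrn] with ξ hξ
    rw [hξ, ENNReal.toReal_ofReal (hr0 ξ)]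
    exact psi_lineMap_deriv_le h.M_nonneg h.divergence h.conj _ h0 h1
  have hdtop : psiDivergence ψ Q P ≠ ⊤ := (hdiv.trans_lt ENNReal.ofReal_lt_top).ne
  have hdr : (psiDivergence ψ Q P).toReal ≤ (1 - θ) * D :=
    ENNReal.toReal_le_of_le_ofReal
      (mul_nonneg (by linarith) (integral_nonneg hD0)) hdiv
  have hql : Integrable (fun ξ => q ξ * loss y ξ) P := hq.integrable_mul (h.memLp_loss y)
  have hEQ : ∫ ξ, loss y ξ ∂Q = (1 - θ) * ∫ ξ, q ξ * loss y ξ ∂P + θ * ∫ ξ, loss y ξ ∂P := by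
    rw [← integral_rnDeriv_smul hQP, ← integral_const_mul, ← integral_const_mul,
      ← integral_add (hql.const_mul _)
        ((h.variance.integrable y).const_mul _)]
    refine integral_congr_ae ?_
    filter_upwards [hrn] with ξ hξ
    rw [hξ, ENNReal.toReal_ofReal (hr0 ξ), smul_eq_mul, hr]
    ring
  have key : ((∫ ξ, loss y ξ ∂Q : ℝ) : EReal) - (lam : EReal) * (psiDivergence ψ Q P : EReal)
      ≤ penalizedObjective loss ψ lam P y :=
    le_iSup_of_le Q (le_iSup_of_le hQprob (le_iSup_of_le hQP le_rfl))
  rw [← ENNReal.ofReal_toReal hdtop, EReal.coe_ennreal_ofReal,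
      max_eq_left ENNReal.toReal_nonneg, ← EReal.coe_mul, ← EReal.coe_sub,
      ← h.coe_penalizedObjectiveReal, EReal.coe_le_coe_iff, hEQ] at key
  have := mul_le_mul_of_nonneg_left hdr h.lam_pos.le
  linarith

/-- The lower bound on the objective given by the density `ψ*' ∘ t`. -/
theorem le_penalizedObjectiveReal {t : Ξ → ℝ} (ht : Measurable t) (ht2 : MemLp t 2 P)
    (hone : ∫ ξ, deriv (conjugateReal ψ) (t ξ) ∂P = 1)
    (hq : MemLp (fun ξ => deriv (conjugateReal ψ) (t ξ)) 2 P) (y : Param d) :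
    ∫ ξ, deriv (conjugateReal ψ) (t ξ) * loss y ξ ∂P
      - lam * ∫ ξ, (deriv (conjugateReal ψ) (t ξ) * t ξ - conjugateReal ψ (t ξ)) ∂P
      ≤ penalizedObjectiveReal loss ψ lam P y := by
  set A := ∫ ξ, deriv (conjugateReal ψ) (t ξ) * loss y ξ ∂P
      - lam * ∫ ξ, (deriv (conjugateReal ψ) (t ξ) * t ξ - conjugateReal ψ (t ξ)) ∂P
  have hlim : Filter.Tendsto (fun θ : ℝ => (1 - θ) * A + θ * ∫ ξ, loss y ξ ∂P)
      (nhdsWithin 0 (Set.Ioo 0 1)) (nhds A) := by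
    have : Continuous fun θ : ℝ => (1 - θ) * A + θ * ∫ ξ, loss y ξ ∂P := by fun_prop
    simpa using (this.tendsto 0).mono_left (nhdsWithin_le_nhds (s := Set.Ioo 0 1))
  have : (nhdsWithin (0 : ℝ) (Set.Ioo 0 1)).NeBot := by
    rw [nhdsWithin_Ioo_eq_nhdsGT zero_lt_one]; infer_instance
  refine le_of_tendsto hlim ?_
  filter_upwards [self_mem_nhdsWithin] with θ hθ
  exact h.lineMap_le_penalizedObjectiveReal ht ht2 hone hq y hθ.1 hθ.2

end IsDROProblem
end Primal
end DRO

/-! ### The optimal density and the gradient of the penalized objective. -/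

namespace DRO

section PrimalGradient

variable {Ξ : Type*} {d : ℕ} [MeasurableSpace Ξ] {G L M σ lam : ℝ} {P : Measure Ξ}
  {loss : Param d → Ξ → ℝ} {ψ : ℝ → ℝ≥0∞}

theorem integral_abs_sub_of_le {f g : Ξ → ℝ} (hf : Integrable f P) (hg : Integrable g P)
    (hg1 : ∫ ξ, g ξ ∂P = 1) (hfg : (∀ ξ, f ξ ≤ g ξ) ∨ ∀ ξ, g ξ ≤ f ξ) :
    ∫ ξ, |f ξ - g ξ| ∂P = |∫ ξ, f ξ ∂P - 1| := by
  rw [← hg1, ← integral_sub hf hg]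
  rcases hfg with h | h
  · rw [abs_of_nonpos (integral_nonpos fun ξ => sub_nonpos.2 (h ξ)), ← integral_neg]
    exact integral_congr_ae (Filter.Eventually.of_forall fun ξ =>
      abs_of_nonpos (sub_nonpos.2 (h ξ)))
  · rw [abs_of_nonneg (integral_nonneg fun ξ => sub_nonneg.2 (h ξ))]
    exact integral_congr_ae (Filter.Eventually.of_forall fun ξ =>
      abs_of_nonneg (sub_nonneg.2 (h ξ)))

namespace IsDROProblem

variable (h : IsDROProblem G L M σ lam P loss ψ)
include h

theorem norm_integral_smul_lossGrad_le {q : Ξ → ℝ} (hq : Integrable q P) (x : Param d) :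
    ‖∫ ξ, q ξ • lossGrad loss x ξ ∂P‖ ≤ G * ∫ ξ, |q ξ| ∂P := by
  rw [mul_comm, ← integral_mul_const]
  refine norm_integral_le_of_norm_le (hq.abs.mul_const G) (Filter.Eventually.of_forall fun ξ => ?_)
  rw [norm_smul]
  exact mul_le_mul_of_nonneg_left (h.norm_lossGrad_le x ξ) (norm_nonneg _)

theorem weight_antitone (x : Param d) (ξ : Ξ) : Antitone fun c => weight loss ψ lam x c ξ :=
  fun c c' hcc => monotone_deriv_conjugateReal h.divergence h.conj
    (div_le_div_of_nonneg_right (by linarith) h.lam_pos.le)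

variable [IsProbabilityMeasure P]

theorem integral_dualSample_sub_le (x y : Param d) (c : ℝ) :
    ∫ ξ, dualSample loss ψ lam y c ξ ∂P - ∫ ξ, dualSample loss ψ lam x c ξ ∂P
      ≤ ∫ ξ, weight loss ψ lam x c ξ * (loss y ξ - loss x ξ) ∂P
        + M / lam * G ^ 2 * ‖y - x‖ ^ 2 := by
  have hi : Integrable (fun ξ => weight loss ψ lam x c ξ * (loss y ξ - loss x ξ)) P :=
    (h.memLp_weight x c).integrable_mul ((h.memLp_loss y).sub (h.memLp_loss x))
  rw [← integral_sub (h.integrable_dualSample y c) (h.integrable_dualSample x c)]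
  have e : ∫ ξ, weight loss ψ lam x c ξ * (loss y ξ - loss x ξ) ∂P
        + M / lam * G ^ 2 * ‖y - x‖ ^ 2
      = ∫ ξ, (weight loss ψ lam x c ξ * (loss y ξ - loss x ξ)
        + M / lam * G ^ 2 * ‖y - x‖ ^ 2) ∂P := by
    rw [integral_add hi (integrable_const _)]; simp
  rw [e]
  refine integral_mono ((h.integrable_dualSample y c).sub (h.integrable_dualSample x c))
    (hi.add (integrable_const _)) fun ξ => ?_
  have h1 := (abs_le.1 (h.abs_dualSample_sub_le x y c c ξ)).2
  simp only [sub_self, mul_zero, add_zero, sub_zero] at h1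
  have h2 : (loss y ξ - loss x ξ) ^ 2 ≤ (G * ‖y - x‖) ^ 2 :=
    sq_le_sq' (by linarith [(abs_le.1 (h.lipschitzSmooth.lipschitz ξ y x)).1])
      (abs_le.1 (h.lipschitzSmooth.lipschitz ξ y x)).2
  have h3 := mul_le_mul_of_nonneg_left h2 (div_nonneg h.M_nonneg h.lam_pos.le)
  have e2 : M / lam * G ^ 2 * ‖y - x‖ ^ 2 = M / lam * (G * ‖y - x‖) ^ 2 := by ring
  simp only [e2]
  linarith

/-- If the slope of the conjugate stays on one side of `1`, then `P` is the only measure of finite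
divergence. -/
theorem penalizedObjectiveReal_eq_integral {s : ℝ} (hs : s ^ 2 = 1)
    (hφ : ∀ u, 0 ≤ s * (deriv (conjugateReal ψ) u - 1)) (y : Param d) :
    penalizedObjectiveReal loss ψ lam P y = ∫ ξ, loss y ξ ∂P := by
  -- With φ' on one side of 1, φ is the identity on a half-line; s = ±1 records which one.
  have hid : ∀ r, 0 ≤ r → conjugateReal ψ (-s * r) = -s * r := fun r hr =>
    conjugateReal_neg_eq h.divergence h.conj fun u => by
      have := mul_nonneg (hφ u) hr
      linarith
  refine le_antisymm ?_ ?_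
  · rw [← EReal.coe_le_coe_iff, h.coe_penalizedObjectiveReal]
    refine h.penalizedObjective_le_of_forall fun Q _ hQP hd => ?_
    set q : Ξ → ℝ := fun ξ => (Q.rnDeriv P ξ).toReal with hq
    have hqm : Measurable q := (Measure.measurable_rnDeriv Q P).ennreal_toReal
    have hqi : Integrable q P := Measure.integrable_toReal_rnDeriv
    have hone : ∫ ξ, q ξ ∂P = 1 := integral_rnDeriv_toReal_eq_one hQP
    set v : Ξ → ℝ := fun ξ => max (-s * (q ξ - 1)) 0 with hv
    have hvi : Integrable v P := ((hqi.sub (integrable_const 1)).const_mul (-s)).pos_part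
    have hv0 : ∀ ξ, 0 ≤ v ξ := fun ξ => le_max_right _ _
    -- Fenchel-Young with the test function -s n on the set where -s(q - 1) ≥ 0 and 0 elsewhere. As
    -- φ is linear there, n may be arbitrarily large, which forces v = 0 almost everywhere. Then s(q
    -- - 1) ≥ 0 has integral 0, so q = 1.
    have hbound : ∀ n : ℕ, n * ∫ ξ, v ξ ∂P ≤ (psiDivergence ψ Q P).toReal := fun n => by
      set A : Set Ξ := {ξ | 0 ≤ -s * (q ξ - 1)}
      have hA : MeasurableSet A := measurableSet_le measurable_const
        ((hqm.sub_const 1).const_mul (-s))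
      have ht : MemLp (A.indicator fun _ => -s * (n : ℝ)) 2 P :=
        (memLp_const _).indicator hA
      obtain ⟨hint, hle⟩ := h.integral_mul_sub_le_psiDivergence hd ht
      rw [← integral_sub hint (h.integrable_conjugate ht)] at hle
      rw [← integral_const_mul]
      refine (le_of_eq (integral_congr_ae (Filter.Eventually.of_forall fun ξ => ?_))).trans hle
      by_cases hξ : ξ ∈ A
      · simp only [Set.indicator_of_mem hξ, hid n n.cast_nonneg, hv, max_eq_left hξ.out]
        change _ = q ξ * _ - _
        ring
      · have : -s * (q ξ - 1) ≤ 0 := (not_le.1 hξ).le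
        simp only [Set.indicator_of_notMem hξ, hv, max_eq_right this,
          conjugateReal_zero h.divergence h.conj]
        ring
    have hvz : ∫ ξ, v ξ ∂P = 0 := by
      refine le_antisymm ?_ (integral_nonneg hv0)
      by_contra! hpos
      obtain ⟨n, hn⟩ := exists_nat_gt ((psiDivergence ψ Q P).toReal / ∫ ξ, v ξ ∂P)
      rw [div_lt_iff₀ hpos] at hn
      linarith [hbound n]
    have hvae := (integral_eq_zero_iff_of_nonneg hv0 hvi).1 hvz
    have hsqi : Integrable (fun ξ => s * (q ξ - 1)) P :=
      (hqi.sub (integrable_const 1)).const_mul s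
    have hw : (fun ξ => s * (q ξ - 1)) =ᵐ[P] 0 := by
      refine (integral_eq_zero_iff_of_nonneg_ae ?_ hsqi).1 ?_
      · filter_upwards [hvae] with ξ hξ
        have := le_max_left (-s * (q ξ - 1)) 0
        simp only [hv, Pi.zero_apply] at hξ ⊢
        linarith
      · rw [integral_const_mul, integral_sub hqi (integrable_const 1), hone]
        simp
    have hEQ : ∫ ξ, loss y ξ ∂Q = ∫ ξ, loss y ξ ∂P := by
      rw [← integral_rnDeriv_smul hQP]
      refine integral_congr_ae ?_
      filter_upwards [hw] with ξ hξ
      have hs0 : s ≠ 0 := by rintro rfl; norm_num at hs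
      have : q ξ = 1 := by
        have := (mul_eq_zero.1 hξ).resolve_left hs0
        linarith
      change q ξ • _ = _
      rw [this, one_smul]
    rw [hEQ]
    have := mul_nonneg h.lam_pos.le (ENNReal.toReal_nonneg (a := psiDivergence ψ Q P))
    linarith
  · rw [← EReal.coe_le_coe_iff, h.coe_penalizedObjectiveReal]
    exact h.integral_loss_le_penalizedObjective y

theorem continuous_integral_weight (x : Param d) :
    Continuous fun c => ∫ ξ, weight loss ψ lam x c ξ ∂P := by
  refine (LipschitzWith.of_dist_le' (K := M / lam) fun c c' => ?_).continuous
  rw [Real.dist_eq, Real.dist_eq, ← integral_sub (h.integrable_weight x c)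
    (h.integrable_weight x c'), ← Real.norm_eq_abs]
  have := norm_integral_le_of_norm_le_const (μ := P)
    (f := fun ξ => weight loss ψ lam x c ξ - weight loss ψ lam x c' ξ)
    (C := M / lam * |c - c'|) (Filter.Eventually.of_forall fun ξ => by
      simpa [abs_sub_comm c c'] using h.abs_weight_sub_le x x c c' ξ)
  simpa using this

/-- For large c most arguments of φ' fall below t, where φ' ≤ φ'(t) < 1. On the remaining tail the
Lipschitz bound adds at most M(z - a) ≤ M z²/(4a), and the second moment makes this small. -/
theorem exists_integral_weight_le (x : Param d) {t : ℝ}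
    (ht : deriv (conjugateReal ψ) t < 1) : ∃ c, ∫ ξ, weight loss ψ lam x c ξ ∂P ≤ 1 := by
  have hl := h.lam_pos
  have hM := h.M_nonneg
  have hX : Integrable (fun ξ => (loss x ξ / lam) ^ 2) P := by
    simpa using (h.memLp_scaled_loss x 0).integrable_sq
  set V := ∫ ξ, (loss x ξ / lam) ^ 2 ∂P
  have hV : 0 ≤ V := integral_nonneg fun ξ => sq_nonneg _
  set δ := 1 - deriv (conjugateReal ψ) t with hδ
  have hδ0 : 0 < δ := sub_pos.2 ht
  -- Chosen so that MV/(4a) = δ·MV/(MV + 1) ≤ δ; the added 1 keeps a positive when MV = 0.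
  set a := (M * V + 1) / (4 * δ) with ha
  have ha0 : 0 < a := by positivity
  refine ⟨lam * (a - t), ?_⟩
  have hpt : ∀ ξ, weight loss ψ lam x (lam * (a - t)) ξ
      ≤ (1 - δ) + M / (4 * a) * (loss x ξ / lam) ^ 2 := fun ξ => by
    have e : (loss x ξ - lam * (a - t)) / lam = loss x ξ / lam - (a - t) := by
      field_simp
    rw [weight, e]
    set z := loss x ξ / lam
    have hsq : M * (z - a) ≤ M / (4 * a) * z ^ 2 := by
      rw [div_mul_eq_mul_div, le_div_iff₀ (by positivity)]
      nlinarith [mul_nonneg hM (sq_nonneg (z - 2 * a))]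
    rcases le_total (z - (a - t)) t with hz | hz
    · have := monotone_deriv_conjugateReal h.divergence h.conj hz
      have : 0 ≤ M / (4 * a) * z ^ 2 := by positivity
      linarith
    · have h1 := (abs_le.1 (abs_deriv_conjugateReal_sub_le h.conj (z - (a - t)) t)).2
      rw [abs_of_nonneg (by linarith)] at h1
      have : z - (a - t) - t = z - a := by ring
      rw [this] at h1
      linarith
  refine (integral_mono (h.integrable_weight x _)
    ((integrable_const _).add (hX.const_mul _)) hpt).trans ?_
  have e2 : ∫ ξ, ((1 - δ) + M / (4 * a) * (loss x ξ / lam) ^ 2) ∂P = (1 - δ) + M / (4 * a) * V := by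
    rw [integral_add (integrable_const _) (hX.const_mul _), integral_const_mul]; simp [V]
  refine e2.le.trans ?_
  have : M / (4 * a) * V ≤ δ := by
    have e4 : 4 * a = (M * V + 1) / δ := by rw [ha]; field_simp
    rw [e4, div_mul_eq_mul_div, div_le_iff₀ (by positivity)]
    field_simp
    linarith
  linarith

/-- The mirror image of `exists_integral_weight_le`, with c shifted in the opposite direction. -/
theorem exists_le_integral_weight (x : Param d) {t : ℝ}
    (ht : 1 < deriv (conjugateReal ψ) t) : ∃ c, 1 ≤ ∫ ξ, weight loss ψ lam x c ξ ∂P := by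
  have hl := h.lam_pos
  have hM := h.M_nonneg
  have hX : Integrable (fun ξ => (loss x ξ / lam) ^ 2) P := by
    simpa using (h.memLp_scaled_loss x 0).integrable_sq
  set V := ∫ ξ, (loss x ξ / lam) ^ 2 ∂P
  have hV : 0 ≤ V := integral_nonneg fun ξ => sq_nonneg _
  set δ := deriv (conjugateReal ψ) t - 1 with hδ
  have hδ0 : 0 < δ := sub_pos.2 ht
  set a := (M * V + 1) / (4 * δ) with ha
  have ha0 : 0 < a := by positivity
  refine ⟨lam * (-a - t), ?_⟩
  have hpt : ∀ ξ, (1 + δ) - M / (4 * a) * (loss x ξ / lam) ^ 2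
      ≤ weight loss ψ lam x (lam * (-a - t)) ξ := fun ξ => by
    have e : (loss x ξ - lam * (-a - t)) / lam = loss x ξ / lam - (-a - t) := by
      field_simp
    rw [weight, e]
    set z := loss x ξ / lam
    have hsq : M * (-z - a) ≤ M / (4 * a) * z ^ 2 := by
      rw [div_mul_eq_mul_div, le_div_iff₀ (by positivity)]
      nlinarith [mul_nonneg hM (sq_nonneg (z + 2 * a))]
    rcases le_total t (z - (-a - t)) with hz | hz
    · have := monotone_deriv_conjugateReal h.divergence h.conj hz
      have : 0 ≤ M / (4 * a) * z ^ 2 := by positivity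
      linarith
    · have h1 := (abs_le.1 (abs_deriv_conjugateReal_sub_le h.conj (z - (-a - t)) t)).1
      rw [abs_of_nonpos (by linarith)] at h1
      have : -(z - (-a - t) - t) = -z - a := by ring
      rw [this] at h1
      linarith
  refine le_trans ?_ (integral_mono ((integrable_const _).sub (hX.const_mul _))
    (h.integrable_weight x _) hpt)
  have e2 : ∫ ξ, ((1 + δ) - M / (4 * a) * (loss x ξ / lam) ^ 2) ∂P = (1 + δ) - M / (4 * a) * V := by
    rw [integral_sub (integrable_const _) (hX.const_mul _), integral_const_mul]; simp [V]
  refine le_trans ?_ e2.ge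
  have : M / (4 * a) * V ≤ δ := by
    have e4 : 4 * a = (M * V + 1) / δ := by rw [ha]; field_simp
    rw [e4, div_mul_eq_mul_div, div_le_iff₀ (by positivity)]
    field_simp
    linarith
  linarith

/-- At every decision there is an optimal density `q`, which gives the gradient of the objective
and lies on one side of every density `weight x c`. -/
theorem exists_optimal_density (x : Param d) :
    ∃ q : Ξ → ℝ, Integrable q P ∧ (∀ ξ, 0 ≤ q ξ) ∧ ∫ ξ, q ξ ∂P = 1 ∧
      (∀ c, ∫ ξ, |weight loss ψ lam x c ξ - q ξ| ∂P = |∫ ξ, weight loss ψ lam x c ξ ∂P - 1|) ∧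
      HasGradientAt (penalizedObjectiveReal loss ψ lam P)
        (∫ ξ, q ξ • lossGrad loss x ξ ∂P) x := by
  -- Degenerate case: φ' never crosses 1, so Ψ(y) = E_P[ℓ(y,·)] and the optimal density is 1.
  have hA : ∀ s : ℝ, s ^ 2 = 1 → (∀ u, 0 ≤ s * (deriv (conjugateReal ψ) u - 1)) →
      HasGradientAt (penalizedObjectiveReal loss ψ lam P)
        (∫ ξ, (1 : ℝ) • lossGrad loss x ξ ∂P) x := fun s hs hφ => by
    refine hasGradientAt_of_abs_sub_le_sq (K := L) fun y => ?_
    rw [h.penalizedObjectiveReal_eq_integral hs hφ, h.penalizedObjectiveReal_eq_integral hs hφ,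
      ← integral_sub (h.variance.integrable y) (h.variance.integrable x)]
    simpa using h.integral_loss_sub_sub_inner_le (q := fun _ => 1) (memLp_const _)
      (fun _ => zero_le_one) x y
  by_cases h1 : ∃ t, deriv (conjugateReal ψ) t < 1
  · by_cases h2 : ∃ t, 1 < deriv (conjugateReal ψ) t
    · obtain ⟨t₁, ht₁⟩ := h1
      obtain ⟨t₂, ht₂⟩ := h2
      -- The intermediate value theorem gives a dual variable c whose weight integrates to 1; this
      -- weight is the optimal density.
      obtain ⟨c, hc⟩ := mem_range_of_exists_le_of_exists_ge (h.continuous_integral_weight x)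
        (h.exists_integral_weight_le x ht₁) (h.exists_le_integral_weight x ht₂)
      replace hc : ∫ ξ, weight loss ψ lam x c ξ ∂P = 1 := hc
      refine ⟨weight loss ψ lam x c, h.integrable_weight x c, h.weight_nonneg x c, hc,
        fun c' => ?_, ?_⟩
      · refine integral_abs_sub_of_le (h.integrable_weight x c') (h.integrable_weight x c) hc ?_
        rcases le_total c c' with hcc | hcc
        · exact Or.inl fun ξ => h.weight_antitone x ξ hcc
        · exact Or.inr fun ξ => h.weight_antitone x ξ hcc
      -- With q and c frozen at x, Ψ(y) lies between the lower bound given by q and the dual value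
      -- at c. The two agree at y = x and have the same first-order term, so Ψ is squeezed up to a
      -- quadratic error.
      · refine hasGradientAt_of_abs_sub_le_sq (K := L + M / lam * G ^ 2) fun y => ?_
        have hl := h.lam_pos
        have hi : ∀ z, Integrable (fun ξ => weight loss ψ lam x c ξ * loss z ξ) P :=
          fun z => h.integrable_weight_mul_loss x z c
        have hgrad := abs_le.1
          (h.integral_loss_sub_sub_inner_le (h.memLp_weight x c) (h.weight_nonneg x c) x y)
        have hlow := h.le_penalizedObjectiveReal
          (((h.variance.measurable x).sub_const c).div_const lam)
          (h.memLp_scaled_loss x c) hc (h.memLp_weight x c)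
        -- Absence of a duality gap at x: the term c(1 - weight) integrates to 0.
        have hD : lam * ∫ ξ, (deriv (conjugateReal ψ) ((loss x ξ - c) / lam)
              * ((loss x ξ - c) / lam) - conjugateReal ψ ((loss x ξ - c) / lam)) ∂P
            = ∫ ξ, weight loss ψ lam x c ξ * loss x ξ ∂P
              - ∫ ξ, dualSample loss ψ lam x c ξ ∂P := by
          have e3 : ∫ ξ, c * (1 - weight loss ψ lam x c ξ) ∂P = 0 := by
            rw [integral_const_mul, integral_sub (integrable_const _) (h.integrable_weight x c), hc]
            simp
          have hi1 : Integrable (fun ξ => weight loss ψ lam x c ξ * loss x ξ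
              - dualSample loss ψ lam x c ξ) P := (hi x).sub (h.integrable_dualSample x c)
          have hi2 : Integrable (fun ξ => c * (1 - weight loss ψ lam x c ξ)) P :=
            ((integrable_const 1).sub (h.integrable_weight x c)).const_mul c
          rw [← integral_const_mul, ← integral_sub (hi x) (h.integrable_dualSample x c),
            ← add_zero (∫ ξ, weight loss ψ lam x c ξ * loss x ξ - _ ∂P), ← e3,
            ← integral_add hi1 hi2]
          refine integral_congr_ae (Filter.Eventually.of_forall fun ξ => ?_)
          simp only [weight, dualSample]
          field_simp
          ring
        have hup := h.penalizedObjectiveReal_le y c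
        have hupx := h.penalizedObjectiveReal_le x c
        have hlowx := hlow x
        have hlowy := hlow y
        rw [hD] at hlowx hlowy
        have hdiff := h.integral_dualSample_sub_le x y c
        have hsub : ∫ ξ, weight loss ψ lam x c ξ * (loss y ξ - loss x ξ) ∂P
            = ∫ ξ, weight loss ψ lam x c ξ * loss y ξ ∂P
              - ∫ ξ, weight loss ψ lam x c ξ * loss x ξ ∂P := by
          rw [← integral_sub (hi y) (hi x)]
          simp only [mul_sub]
        rw [hc, mul_one] at hgrad
        change ∫ ξ, weight loss ψ lam x c ξ * loss x ξ ∂P - _ ≤ _ at hlowx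
        change ∫ ξ, weight loss ψ lam x c ξ * loss y ξ ∂P - _ ≤ _ at hlowy
        have hpos : 0 ≤ M / lam * G ^ 2 * ‖y - x‖ ^ 2 :=
          mul_nonneg (mul_nonneg (div_nonneg h.M_nonneg hl.le) (sq_nonneg _)) (sq_nonneg _)
        rw [add_mul, abs_le]
        constructor <;> linarith
    · push Not at h2
      refine ⟨fun _ => 1, integrable_const _, fun _ => zero_le_one, by simp, fun c => ?_,
        hA (-1) (by norm_num) fun u => by linarith [h2 u]⟩
      exact integral_abs_sub_of_le (h.integrable_weight x c) (integrable_const _) (by simp)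
        (Or.inl fun ξ => h2 _)
  · push Not at h1
    refine ⟨fun _ => 1, integrable_const _, fun _ => zero_le_one, by simp, fun c => ?_,
      hA 1 (by norm_num) fun u => by linarith [h1 u]⟩
    exact integral_abs_sub_of_le (h.integrable_weight x c) (integrable_const _) (by simp)
      (Or.inr fun ξ => h1 _)

theorem differentiable_penalizedObjectiveReal :
    Differentiable ℝ (penalizedObjectiveReal loss ψ lam P) := fun x => by
  obtain ⟨q, -, -, -, -, hg⟩ := h.exists_optimal_density x
  exact hg.differentiableAt

theorem norm_gradient_penalizedObjectiveReal_le (x : Param d) :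
    ‖gradient (penalizedObjectiveReal loss ψ lam P) x‖ ≤ G := by
  obtain ⟨q, hq, hq0, hq1, -, hg⟩ := h.exists_optimal_density x
  rw [hg.gradient]
  refine (h.norm_integral_smul_lossGrad_le hq x).trans ?_
  simp only [abs_of_nonneg (hq0 _), hq1, mul_one, le_refl]

/-- Replacing the optimal density by the weight for c costs at most G times their L¹ distance, and
one-sidedness turns that distance into |E[weight] - 1|. No optimality of c is required. -/
theorem norm_gradient_penalizedObjectiveReal_le_add (x : Param d) (c : ℝ) :
    ‖gradient (penalizedObjectiveReal loss ψ lam P) x‖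
      ≤ ‖∫ ξ, weight loss ψ lam x c ξ • lossGrad loss x ξ ∂P‖
        + G * |∫ ξ, weight loss ψ lam x c ξ ∂P - 1| := by
  obtain ⟨q, hq, hq0, hq1, hqc, hg⟩ := h.exists_optimal_density x
  have hw := h.integrable_weight x c
  rw [hg.gradient, ← hqc c]
  have e : ∫ ξ, q ξ • lossGrad loss x ξ ∂P = ∫ ξ, weight loss ψ lam x c ξ • lossGrad loss x ξ ∂P
      - ∫ ξ, (weight loss ψ lam x c ξ - q ξ) • lossGrad loss x ξ ∂P := by
    rw [← integral_sub (h.integrable_smul_lossGrad hw x)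
      (h.integrable_smul_lossGrad (q := fun ξ => weight loss ψ lam x c ξ - q ξ) (hw.sub hq) x)]
    refine integral_congr_ae (Filter.Eventually.of_forall fun ξ => ?_)
    simp only [sub_smul]
    abel
  rw [e]
  exact (norm_sub_le _ _).trans (add_le_add_right
    (h.norm_integral_smul_lossGrad_le (q := fun ξ => weight loss ψ lam x c ξ - q ξ)
      (hw.sub hq) x) _)

end IsDROProblem
end PrimalGradient
end DRO

namespace DRO

/-! ### Second moments around the mean. -/

section Variance

variable {Ξ E : Type*} [MeasurableSpace Ξ] {P : Measure Ξ} [IsProbabilityMeasure P]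
  [NormedAddCommGroup E] [InnerProductSpace ℝ E] [CompleteSpace E]

/-- The mean minimises the expected squared distance. -/
theorem integral_norm_sub_integral_sq {X : Ξ → E} (hX : MemLp X 2 P) (v : E) :
    ∫ ξ, ‖X ξ - ∫ ζ, X ζ ∂P‖ ^ 2 ∂P = ∫ ξ, ‖X ξ - v‖ ^ 2 ∂P - ‖∫ ζ, X ζ ∂P - v‖ ^ 2 := by
  set m := ∫ ζ, X ζ ∂P with hm
  have hXi := hX.integrable one_le_two
  have hsq : ∀ u, Integrable (fun ξ => ‖X ξ - u‖ ^ 2) P := fun u =>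
    (hX.sub (memLp_const u)).norm.integrable_sq
  have hin : Integrable (fun ξ => inner ℝ (m - v) (X ξ - m)) P :=
    (hXi.sub (integrable_const m)).const_inner _
  have hzero : ∫ ξ, inner ℝ (m - v) (X ξ - m) ∂P = 0 := by
    have hs : Integrable (fun ξ => X ξ - m) P := hXi.sub (integrable_const m)
    rw [integral_inner hs, integral_sub hXi (integrable_const m)]
    simp [← hm]
  have e : ∫ ξ, ‖X ξ - v‖ ^ 2 ∂P
      = ∫ ξ, (‖X ξ - m‖ ^ 2 + 2 * inner ℝ (m - v) (X ξ - m) + ‖m - v‖ ^ 2) ∂P := by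
    refine integral_congr_ae (Filter.Eventually.of_forall fun ξ => ?_)
    have : X ξ - v = (X ξ - m) + (m - v) := by abel
    simp only [this, norm_add_sq_real, real_inner_comm]
  have hadd : Integrable (fun ξ => ‖X ξ - m‖ ^ 2 + 2 * inner ℝ (m - v) (X ξ - m)) P :=
    (hsq m).add (hin.const_mul 2)
  rw [e, integral_add hadd (integrable_const _), integral_add (hsq m) (hin.const_mul 2),
    integral_const_mul, hzero]
  simp

theorem integral_norm_sub_integral_sq_le {X : Ξ → E} (hX : MemLp X 2 P) (v : E) :
    ∫ ξ, ‖X ξ - ∫ ζ, X ζ ∂P‖ ^ 2 ∂P ≤ ∫ ξ, ‖X ξ - v‖ ^ 2 ∂P := by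
  rw [integral_norm_sub_integral_sq hX v]
  linarith [sq_nonneg ‖∫ ζ, X ζ ∂P - v‖]

end Variance

theorem sq_integral_norm_le {Ξ E : Type*} [MeasurableSpace Ξ] {P : Measure Ξ}
    [IsProbabilityMeasure P] [NormedAddCommGroup E] {X : Ξ → E} (hX : MemLp X 2 P) :
    (∫ ξ, ‖X ξ‖ ∂P) ^ 2 ≤ ∫ ξ, ‖X ξ‖ ^ 2 ∂P := by
  have h1 := integral_norm_sub_integral_sq hX.norm 0
  have h2 : 0 ≤ ∫ ξ, ‖‖X ξ‖ - ∫ ζ, ‖X ζ‖ ∂P‖ ^ 2 ∂P := integral_nonneg fun ξ => sq_nonneg _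
  simp only [sub_zero, Real.norm_eq_abs, sq_abs] at h1 h2
  linarith

/-! ### Gradient, generalized smoothness and noise of the rescaled dual. -/

section RescaledDual

variable {Ξ : Type*} {d : ℕ} [MeasurableSpace Ξ] {G L M σ lam : ℝ} {P : Measure Ξ}
  {loss : Param d → Ξ → ℝ} {ψ : ℝ → ℝ≥0∞}

/-- The weight of a sample at the rescaled dual parameter `w = (x, η)`. -/
noncomputable def dualWeight (loss : Param d → Ξ → ℝ) (ψ : ℝ → ℝ≥0∞) (lam G : ℝ)
    (w : DualParam d) (ξ : Ξ) : ℝ :=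
  weight loss ψ lam w.fst (G * w.snd) ξ

/-- The gradient of the stochastic rescaled dual objective. -/
noncomputable def dualGradSample (loss : Param d → Ξ → ℝ) (ψ : ℝ → ℝ≥0∞) (lam G : ℝ)
    (w : DualParam d) (ξ : Ξ) : DualParam d :=
  WithLp.toLp 2 (dualWeight loss ψ lam G w ξ • lossGrad loss w.fst ξ,
    G * (1 - dualWeight loss ψ lam G w ξ))

/-- The gradient of the rescaled dual objective. -/
noncomputable def dualGrad (loss : Param d → Ξ → ℝ) (ψ : ℝ → ℝ≥0∞) (lam G : ℝ) (P : Measure Ξ)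
    (w : DualParam d) : DualParam d :=
  ∫ ξ, dualGradSample loss ψ lam G w ξ ∂P

theorem norm_le_norm_fst_add_abs_snd (w : DualParam d) : ‖w‖ ≤ ‖w.fst‖ + |w.snd| := by
  refine abs_le_of_sq_le_sq' ?_ (by positivity) |>.2
  rw [WithLp.prod_norm_sq_eq_of_L2, Real.norm_eq_abs]
  nlinarith [mul_nonneg (norm_nonneg w.fst) (abs_nonneg w.snd)]

theorem norm_fst_add_abs_snd_le (w : DualParam d) : ‖w.fst‖ + |w.snd| ≤ √2 * ‖w‖ := by
  refine abs_le_of_sq_le_sq' ?_ (by positivity) |>.2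
  rw [mul_pow, Real.sq_sqrt zero_le_two, WithLp.prod_norm_sq_eq_of_L2, Real.norm_eq_abs]
  nlinarith [sq_nonneg (‖w.fst‖ - |w.snd|)]

namespace IsDROProblem

variable (h : IsDROProblem G L M σ lam P loss ψ)
include h

theorem abs_loss_sub_sub_le (w v : DualParam d) (ξ : Ξ) :
    |(loss v.fst ξ - loss w.fst ξ) - (G * v.snd - G * w.snd)|
      ≤ G * (‖(v - w).fst‖ + |(v - w).snd|) := by
  rw [mul_add]
  refine (abs_sub _ _).trans (add_le_add ?_ ?_)
  · simpa using h.lipschitzSmooth.lipschitz ξ v.fst w.fst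
  · rw [← mul_sub, abs_mul, abs_of_nonneg h.G_nonneg, WithLp.sub_snd]

theorem dualWeight_nonneg (w : DualParam d) (ξ : Ξ) : 0 ≤ dualWeight loss ψ lam G w ξ :=
  h.weight_nonneg _ _ ξ

theorem abs_dualWeight_sub_le (w v : DualParam d) (ξ : Ξ) :
    |dualWeight loss ψ lam G w ξ - dualWeight loss ψ lam G v ξ|
      ≤ 2 * (M / lam) * G * ‖w - v‖ := by
  have hMl := div_nonneg h.M_nonneg h.lam_pos.le
  refine (h.abs_weight_sub_le _ _ _ _ ξ).trans ?_
  have h1 := h.abs_loss_sub_sub_le v w ξ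
  have h2 : ‖(w - v).fst‖ + |(w - v).snd| ≤ 2 * ‖w - v‖ := by
    have := WithLp.norm_fst_le _ (w - v)
    have := WithLp.norm_snd_le _ (w - v)
    rw [Real.norm_eq_abs] at this
    linarith
  calc _ ≤ M / lam * (G * (2 * ‖w - v‖)) := by
        refine mul_le_mul_of_nonneg_left (h1.trans ?_) hMl
        exact mul_le_mul_of_nonneg_left h2 h.G_nonneg
    _ = _ := by ring

/-- The change of the weight enters both components, each contributing 2(M/λ)G², and the change of
∇ℓ is multiplied by the weight at `w`. Keeping only the weight at `w` lets the expectation be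
bounded through the gradient at `w`. -/
theorem norm_dualGradSample_sub_le (w v : DualParam d) (ξ : Ξ) :
    ‖dualGradSample loss ψ lam G w ξ - dualGradSample loss ψ lam G v ξ‖
      ≤ (4 * (M / lam) * G ^ 2 + L * dualWeight loss ψ lam G w ξ) * ‖w - v‖ := by
  have hq := h.abs_dualWeight_sub_le w v ξ
  have hG := h.G_nonneg
  refine (norm_le_norm_fst_add_abs_snd _).trans ?_
  set q := dualWeight loss ψ lam G w ξ with hqd
  set q' := dualWeight loss ψ lam G v ξ with hqd'
  have e1 : (dualGradSample loss ψ lam G w ξ - dualGradSample loss ψ lam G v ξ).fst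
      = q • (lossGrad loss w.fst ξ - lossGrad loss v.fst ξ) + (q - q') • lossGrad loss v.fst ξ := by
    simp only [dualGradSample, WithLp.sub_fst, WithLp.toLp_fst, ← hqd, ← hqd']
    module
  have e2 : (dualGradSample loss ψ lam G w ξ - dualGradSample loss ψ lam G v ξ).snd
      = -(G * (q - q')) := by
    simp only [dualGradSample, WithLp.sub_snd, WithLp.toLp_snd, ← hqd, ← hqd']
    ring
  have hq0 : 0 ≤ q := h.dualWeight_nonneg w ξ
  have h1 : ‖q • (lossGrad loss w.fst ξ - lossGrad loss v.fst ξ)‖ ≤ q * (L * ‖w - v‖) := by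
    rw [norm_smul, Real.norm_of_nonneg hq0]
    refine mul_le_mul_of_nonneg_left ((h.norm_lossGrad_sub_le _ _ ξ).trans ?_) hq0
    exact mul_le_mul_of_nonneg_left (WithLp.norm_fst_le _ (w - v)) h.L_nonneg
  have h2 : ‖(q - q') • lossGrad loss v.fst ξ‖ ≤ |q - q'| * G := by
    rw [norm_smul]
    exact mul_le_mul_of_nonneg_left (h.norm_lossGrad_le _ ξ) (norm_nonneg _)
  rw [e1, e2, abs_neg, abs_mul, abs_of_nonneg hG]
  have h3 := norm_add_le (q • (lossGrad loss w.fst ξ - lossGrad loss v.fst ξ))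
    ((q - q') • lossGrad loss v.fst ξ)
  have h4 := mul_le_mul_of_nonneg_left hq hG
  linarith

theorem abs_rescaledDualSample_sub_le (w v : DualParam d) (ξ : Ξ) :
    |rescaledDualSample loss ψ lam G v ξ - rescaledDualSample loss ψ lam G w ξ
      - inner ℝ (dualGradSample loss ψ lam G w ξ) (v - w)|
      ≤ (4 * (M / lam) * G ^ 2 + L * dualWeight loss ψ lam G w ξ) * ‖v - w‖ ^ 2 := by
  have hMl := div_nonneg h.M_nonneg h.lam_pos.le
  set q := dualWeight loss ψ lam G w ξ with hqd
  have hq0 : 0 ≤ q := h.dualWeight_nonneg w ξ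
  have h1 := h.abs_dualSample_sub_le w.fst v.fst (G * w.snd) (G * v.snd) ξ
  have h2 := h.abs_loss_sub_sub_inner_le w.fst v.fst ξ
  have hnsq : ‖v - w‖ ^ 2 = ‖(v - w).fst‖ ^ 2 + |(v - w).snd| ^ 2 := by
    rw [WithLp.prod_norm_sq_eq_of_L2, Real.norm_eq_abs]
  have h3 : ((loss v.fst ξ - loss w.fst ξ) - (G * v.snd - G * w.snd)) ^ 2
      ≤ 4 * G ^ 2 * ‖v - w‖ ^ 2 := by
    rw [← sq_abs]
    refine (pow_le_pow_left₀ (abs_nonneg _) (h.abs_loss_sub_sub_le w v ξ) 2).trans ?_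
    rw [hnsq]
    nlinarith [sq_nonneg (G * (‖(v - w).fst‖ - |(v - w).snd|)),
      sq_nonneg (G * ‖(v - w).fst‖), sq_nonneg (G * |(v - w).snd|)]
  have h4 : ‖v.fst - w.fst‖ ^ 2 ≤ ‖v - w‖ ^ 2 := by
    rw [hnsq, WithLp.sub_fst]
    linarith [sq_nonneg |(v - w).snd|]
  have e : inner ℝ (dualGradSample loss ψ lam G w ξ) (v - w)
      = q * inner ℝ (lossGrad loss w.fst ξ) (v.fst - w.fst)
        + (1 - q) * (G * v.snd - G * w.snd) := by
    rw [WithLp.prod_inner_apply]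
    simp only [dualGradSample, ← hqd, real_inner_smul_left]
    simp
    ring
  have h5 : |q * (loss v.fst ξ - loss w.fst ξ
      - inner ℝ (lossGrad loss w.fst ξ) (v.fst - w.fst))| ≤ q * (L * ‖v - w‖ ^ 2) := by
    rw [abs_mul, abs_of_nonneg hq0]
    exact mul_le_mul_of_nonneg_left (h2.trans (mul_le_mul_of_nonneg_left h4 h.L_nonneg)) hq0
  have h6 := h1.trans (mul_le_mul_of_nonneg_left h3 hMl)
  change |rescaledDualSample loss ψ lam G v ξ - rescaledDualSample loss ψ lam G w ξ
    - (q * (loss v.fst ξ - loss w.fst ξ) + (1 - q) * (G * v.snd - G * w.snd))| ≤ _ at h6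
  rw [abs_le] at h5 h6 ⊢
  rw [e]
  constructor <;> linarith [h5.1, h5.2, h6.1, h6.2]

theorem gradient_rescaledDualSample (w : DualParam d) (ξ : Ξ) :
    gradient (fun v => rescaledDualSample loss ψ lam G v ξ) w = dualGradSample loss ψ lam G w ξ :=
  (hasGradientAt_of_abs_sub_le_sq fun v => h.abs_rescaledDualSample_sub_le w v ξ).gradient

theorem measurable_dualGradSample (w : DualParam d) :
    Measurable (dualGradSample loss ψ lam G w) := by
  refine (WithLp.measurable_toLp 2 _).comp (Measurable.prodMk ?_ ?_)
  · exact (h.measurable_weight _ _).smul (h.measurable_lossGrad _)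
  · exact (measurable_const.sub (h.measurable_weight _ _)).const_mul G

theorem continuous_dualGradSample (ξ : Ξ) :
    Continuous fun w => dualGradSample loss ψ lam G w ξ := by
  rw [continuous_iff_continuousAt]
  intro w
  rw [ContinuousAt, tendsto_iff_norm_sub_tendsto_zero]
  simp only [norm_sub_rev _ (dualGradSample loss ψ lam G w ξ)]
  refine squeeze_zero (fun _ => norm_nonneg _) (fun v => h.norm_dualGradSample_sub_le w v ξ) ?_
  have : Continuous fun v => (4 * (M / lam) * G ^ 2 + L * dualWeight loss ψ lam G w ξ)
    * ‖w - v‖ := by fun_prop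
  simpa using this.tendsto w

/-- Continuity in `w` and measurability in ξ give joint measurability, needed once `w` is random. -/
theorem measurable_uncurry_dualGradSample :
    Measurable (Function.uncurry (dualGradSample loss ψ lam G)) := by
  have := measurable_uncurry_of_continuous_of_measurable
    (u := fun w ξ => dualGradSample loss ψ lam G w ξ)
    h.continuous_dualGradSample h.measurable_dualGradSample
  exact this

theorem integral_loss_sub_integral_sq_le (x : Param d) :
    ∫ ξ, (loss x ξ - ∫ ζ, loss x ζ ∂P) ^ 2 ∂P ≤ σ ^ 2 := by
  rw [← variance_eq_integral (h.variance.measurable x).aemeasurable]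
  exact ENNReal.toReal_le_of_le_ofReal (sq_nonneg _) (h.variance.variance_le x)

variable [IsProbabilityMeasure P]

theorem memLp_dualWeight (w : DualParam d) : MemLp (dualWeight loss ψ lam G w) 2 P :=
  h.memLp_weight _ _

theorem integrable_dualWeight (w : DualParam d) : Integrable (dualWeight loss ψ lam G w) P :=
  h.integrable_weight _ _

theorem memLp_dualGradSample (w : DualParam d) : MemLp (dualGradSample loss ψ lam G w) 2 P := by
  have hq := h.memLp_dualWeight w
  have hb : MemLp (fun ξ => ‖dualWeight loss ψ lam G w ξ‖ * G
      + G * ‖1 - dualWeight loss ψ lam G w ξ‖) 2 P :=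
    (hq.norm.mul_const G).add (((memLp_const 1).sub hq).norm.const_mul G)
  refine hb.mono' (h.measurable_dualGradSample w).aestronglyMeasurable
    (Filter.Eventually.of_forall fun ξ => (norm_le_norm_fst_add_abs_snd _).trans ?_)
  simp only [dualGradSample, WithLp.toLp_fst, WithLp.toLp_snd, norm_smul, abs_mul,
    abs_of_nonneg h.G_nonneg, Real.norm_eq_abs]
  exact add_le_add_left (mul_le_mul_of_nonneg_left (h.norm_lossGrad_le _ ξ) (abs_nonneg _)) _

theorem integrable_dualGradSample (w : DualParam d) :
    Integrable (dualGradSample loss ψ lam G w) P :=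
  (h.memLp_dualGradSample w).integrable one_le_two

theorem dualGrad_fst (w : DualParam d) : (dualGrad loss ψ lam G P w).fst
    = ∫ ξ, dualWeight loss ψ lam G w ξ • lossGrad loss w.fst ξ ∂P :=
  ((WithLp.fstL 2 ℝ (Param d) ℝ).integral_comp_comm (h.integrable_dualGradSample w)).symm

theorem dualGrad_snd (w : DualParam d) : (dualGrad loss ψ lam G P w).snd
    = G * (1 - ∫ ξ, dualWeight loss ψ lam G w ξ ∂P) := by
  have := ((WithLp.sndL 2 ℝ (Param d) ℝ).integral_comp_comm (h.integrable_dualGradSample w)).symm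
  refine this.trans ?_
  change ∫ ξ, G * (1 - dualWeight loss ψ lam G w ξ) ∂P = _
  rw [integral_const_mul, integral_sub (integrable_const _) (h.integrable_dualWeight w)]
  simp

theorem mul_abs_integral_dualWeight_sub_one_le (w : DualParam d) :
    G * |∫ ξ, dualWeight loss ψ lam G w ξ ∂P - 1| ≤ ‖dualGrad loss ψ lam G P w‖ := by
  have := WithLp.norm_snd_le _ (dualGrad loss ψ lam G P w)
  rwa [h.dualGrad_snd, Real.norm_eq_abs, abs_mul, abs_of_nonneg h.G_nonneg, abs_sub_comm] at this

/-- The error term G|E[weight] - 1| is exactly the size of the η-component, thanks to the scaling of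
η by G. -/
theorem norm_gradient_penalizedObjectiveReal_le_norm_dualGrad (w : DualParam d) :
    ‖gradient (penalizedObjectiveReal loss ψ lam P) w.fst‖
      ≤ √2 * ‖dualGrad loss ψ lam G P w‖ := by
  refine (h.norm_gradient_penalizedObjectiveReal_le_add w.fst (G * w.snd)).trans
    (le_trans (le_of_eq ?_) (norm_fst_add_abs_snd_le _))
  rw [h.dualGrad_fst, h.dualGrad_snd, abs_mul, abs_of_nonneg h.G_nonneg, abs_sub_comm 1]
  rfl

theorem integral_smoothness (w : DualParam d) (r : ℝ) :
    Integrable (fun ξ => (4 * (M / lam) * G ^ 2 + L * dualWeight loss ψ lam G w ξ) * r) P ∧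
    ∫ ξ, (4 * (M / lam) * G ^ 2 + L * dualWeight loss ψ lam G w ξ) * r ∂P
      = (4 * (M / lam) * G ^ 2 + L * ∫ ξ, dualWeight loss ψ lam G w ξ ∂P) * r := by
  have hq := (h.integrable_dualWeight w).const_mul L
  refine ⟨((integrable_const _).add hq).mul_const r, ?_⟩
  rw [integral_mul_const, integral_add (integrable_const _) hq, integral_const_mul L]
  simp

/-- The η-component of the gradient controls the mean weight: E[weight] ≤ 1 + ‖∇L̂‖/G. This is the
source of the smoothness constant affine in the gradient norm. -/
theorem smoothness_le (hG : 0 < G) (w : DualParam d) :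
    4 * (M / lam) * G ^ 2 + L * ∫ ξ, dualWeight loss ψ lam G w ξ ∂P
      ≤ (4 * (M / lam) * G ^ 2 + L) + L / G * ‖dualGrad loss ψ lam G P w‖ := by
  have h1 := h.mul_abs_integral_dualWeight_sub_one_le w
  have h2 := le_abs_self (∫ ξ, dualWeight loss ψ lam G w ξ ∂P - 1)
  have h3 : ∫ ξ, dualWeight loss ψ lam G w ξ ∂P - 1 ≤ ‖dualGrad loss ψ lam G P w‖ / G := by
    rw [le_div_iff₀ hG]
    nlinarith
  have h4 := mul_le_mul_of_nonneg_left h3 h.L_nonneg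
  have : L / G * ‖dualGrad loss ψ lam G P w‖ = L * (‖dualGrad loss ψ lam G P w‖ / G) := by ring
  linarith

theorem norm_dualGrad_sub_le (hG : 0 < G) (w v : DualParam d) :
    ‖dualGrad loss ψ lam G P w - dualGrad loss ψ lam G P v‖
      ≤ ((4 * (M / lam) * G ^ 2 + L) + L / G * ‖dualGrad loss ψ lam G P w‖) * ‖w - v‖ := by
  obtain ⟨hi, he⟩ := h.integral_smoothness w ‖w - v‖
  rw [dualGrad, dualGrad, ← integral_sub (h.integrable_dualGradSample w)
    (h.integrable_dualGradSample v)]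
  refine (norm_integral_le_of_norm_le hi (Filter.Eventually.of_forall fun ξ =>
    h.norm_dualGradSample_sub_le w v ξ)).trans ?_
  rw [he]
  exact mul_le_mul_of_nonneg_right (h.smoothness_le hG w) (norm_nonneg _)

theorem abs_rescaledDual_sub_le_weight (w v : DualParam d) :
    |rescaledDual loss ψ lam G P v - rescaledDual loss ψ lam G P w
      - inner ℝ (dualGrad loss ψ lam G P w) (v - w)|
      ≤ (4 * (M / lam) * G ^ 2 + L * ∫ ξ, dualWeight loss ψ lam G w ξ ∂P) * ‖v - w‖ ^ 2 := by
  obtain ⟨hi, he⟩ := h.integral_smoothness w (‖v - w‖ ^ 2)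
  have hf : ∀ u : DualParam d, Integrable (rescaledDualSample loss ψ lam G u) P :=
    fun u => h.integrable_dualSample u.fst (G * u.snd)
  have hg := h.integrable_dualGradSample w
  have key := norm_integral_le_of_norm_le hi (Filter.Eventually.of_forall fun ξ =>
    (Real.norm_eq_abs _).trans_le (h.abs_rescaledDualSample_sub_le w v ξ))
  have hd : Integrable (fun ξ => rescaledDualSample loss ψ lam G v ξ
    - rescaledDualSample loss ψ lam G w ξ) P := (hf v).sub (hf w)
  have hin : Integrable (fun ξ => inner ℝ (dualGradSample loss ψ lam G w ξ) (v - w)) P :=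
    hg.inner_const _
  have e : ∫ ξ, inner ℝ (dualGradSample loss ψ lam G w ξ) (v - w) ∂P
      = inner ℝ (dualGrad loss ψ lam G P w) (v - w) := by
    simp only [real_inner_comm (v - w)]
    exact integral_inner hg _
  rwa [integral_sub hd hin, integral_sub (hf v) (hf w), e, he, Real.norm_eq_abs] at key

theorem gradient_rescaledDual (w : DualParam d) :
    gradient (rescaledDual loss ψ lam G P) w = dualGrad loss ψ lam G P w :=
  (hasGradientAt_of_abs_sub_le_sq fun v => h.abs_rescaledDual_sub_le_weight w v).gradient

theorem rescaledDual_le (hG : 0 < G) (w v : DualParam d) :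
    rescaledDual loss ψ lam G P v ≤ rescaledDual loss ψ lam G P w
      + inner ℝ (dualGrad loss ψ lam G P w) (v - w)
      + ((4 * (M / lam) * G ^ 2 + L) + L / G * ‖dualGrad loss ψ lam G P w‖) * ‖v - w‖ ^ 2 := by
  have h1 := (abs_le.1 (h.abs_rescaledDual_sub_le_weight w v)).2
  have h2 := mul_le_mul_of_nonneg_right (h.smoothness_le hG w) (sq_nonneg ‖v - w‖)
  linarith

/-- The mean may be replaced by the weight at the mean loss, after which φ' being M-Lipschitz
transfers the variance of the loss. -/
theorem integral_dualWeight_sub_integral_sq_le (w : DualParam d) :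
    ∫ ξ, (dualWeight loss ψ lam G w ξ - ∫ ζ, dualWeight loss ψ lam G w ζ ∂P) ^ 2 ∂P
      ≤ (M / lam) ^ 2 * σ ^ 2 := by
  set m := ∫ ζ, loss w.fst ζ ∂P
  set c := deriv (conjugateReal ψ) ((m - G * w.snd) / lam) with hc
  have h1 := integral_norm_sub_integral_sq_le (h.memLp_dualWeight w) c
  simp only [Real.norm_eq_abs, sq_abs] at h1
  refine h1.trans ?_
  have h2 : Integrable (fun ξ => (loss w.fst ξ - m) ^ 2) P :=
    ((h.memLp_loss w.fst).sub (memLp_const m)).integrable_sq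
  refine (integral_mono (((h.memLp_dualWeight w).sub (memLp_const c)).integrable_sq)
    (h2.const_mul ((M / lam) ^ 2)) fun ξ => ?_).trans ?_
  · simp only [Pi.sub_apply]
    rw [← mul_pow]
    refine sq_le_sq.2 ?_
    have hl := h.lam_pos
    have := abs_deriv_conjugateReal_sub_le h.conj ((loss w.fst ξ - G * w.snd) / lam)
      ((m - G * w.snd) / lam)
    refine this.trans (le_of_eq ?_)
    rw [abs_mul, abs_of_nonneg (div_nonneg h.M_nonneg hl.le), ← sub_div, abs_div,
      abs_of_pos hl, sub_sub_sub_cancel_right]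
    ring
  · rw [integral_const_mul]
    exact mul_le_mul_of_nonneg_left (h.integral_loss_sub_integral_sq_le w.fst) (sq_nonneg _)

/-- The variance of the stochastic gradients. -/
theorem integral_norm_dualGradSample_sub_sq_le (w : DualParam d) :
    ∫ ξ, ‖dualGradSample loss ψ lam G w ξ - dualGrad loss ψ lam G P w‖ ^ 2 ∂P
      ≤ 2 * G ^ 2 * ((M / lam) ^ 2 * σ ^ 2 + 1) + 2 * ‖dualGrad loss ψ lam G P w‖ ^ 2 := by
  have hq := h.memLp_dualWeight w
  have hvar := h.integral_dualWeight_sub_integral_sq_le w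
  have hm := h.mul_abs_integral_dualWeight_sub_one_le w
  have hsec := integral_norm_sub_integral_sq hq 0
  simp only [Real.norm_eq_abs, sq_abs, sub_zero] at hsec
  set m := ∫ ζ, dualWeight loss ψ lam G w ζ ∂P with hmdef
  have hX1 : Integrable (fun ξ => dualWeight loss ψ lam G w ξ ^ 2) P := hq.integrable_sq
  have hX2 : Integrable (fun ξ => (dualWeight loss ψ lam G w ξ - m) ^ 2) P :=
    (hq.sub (memLp_const m)).integrable_sq
  -- Centring at (0, G(1 - m)) instead of the mean avoids the variance of ∇ℓ: the x-part contributes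
  -- G²E[weight²] = G²(Var + m²), the η-part G²Var.
  refine (integral_norm_sub_integral_sq_le (h.memLp_dualGradSample w)
    (WithLp.toLp 2 (0, G * (1 - m)))).trans ?_
  have hle : ∫ ξ, ‖dualGradSample loss ψ lam G w ξ - WithLp.toLp 2 (0, G * (1 - m))‖ ^ 2 ∂P
      ≤ ∫ ξ, G ^ 2 * (dualWeight loss ψ lam G w ξ ^ 2
        + (dualWeight loss ψ lam G w ξ - m) ^ 2) ∂P := by
    refine integral_mono
      (((h.memLp_dualGradSample w).sub (memLp_const _)).norm.integrable_sq)
      ((hX1.add hX2).const_mul _) fun ξ => ?_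
    simp only [WithLp.prod_norm_sq_eq_of_L2, dualGradSample, WithLp.sub_fst, WithLp.sub_snd,
      WithLp.toLp_fst, WithLp.toLp_snd, sub_zero, norm_smul, mul_pow, Real.norm_eq_abs, sq_abs]
    have h1 := mul_le_mul_of_nonneg_left
      (pow_le_pow_left₀ (norm_nonneg _) (h.norm_lossGrad_le w.fst ξ) 2)
      (sq_nonneg (dualWeight loss ψ lam G w ξ))
    linarith
  refine hle.trans ?_
  rw [integral_const_mul, integral_add hX1 hX2]
  have h3 : (G * |m - 1|) ^ 2 ≤ ‖dualGrad loss ψ lam G P w‖ ^ 2 :=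
    pow_le_pow_left₀ (mul_nonneg h.G_nonneg (abs_nonneg _)) hm 2
  rw [mul_pow, sq_abs] at h3
  have h4 := mul_le_mul_of_nonneg_left hvar (sq_nonneg G)
  have h5 : ∫ ξ, dualWeight loss ψ lam G w ξ ^ 2 ∂P
      = ∫ ξ, (dualWeight loss ψ lam G w ξ - m) ^ 2 ∂P + m ^ 2 := by linarith
  rw [h5]
  -- Uses m² ≤ 2 + 2(m - 1)², which is (m - 2)² ≥ 0.
  nlinarith [sq_nonneg (G * (m - 2))]

end IsDROProblem
end RescaledDual
end DRO

/-! ### Independence and batch averages. -/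

namespace DRO

section Decoupling

variable {Ω α β : Type*} [MeasurableSpace Ω] [MeasurableSpace α] [MeasurableSpace β]
  {μ : Measure Ω} [IsProbabilityMeasure μ] {Y : Ω → α} {Z : Ω → β}

theorem integral_eq_zero_of_indepFun (hY : Measurable Y) (hZ : Measurable Z)
    (hYZ : IndepFun Y Z μ) {H : α → β → ℝ} (hH : Measurable (Function.uncurry H))
    (hi : Integrable (fun ω => H (Y ω) (Z ω)) μ)
    (h0 : ∀ y, ∫ ω, H y (Z ω) ∂μ = 0) : ∫ ω, H (Y ω) (Z ω) ∂μ = 0 := by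
  have hmap := (indepFun_iff_map_prod_eq_prod_map_map hY.aemeasurable hZ.aemeasurable).1 hYZ
  have : IsProbabilityMeasure (μ.map Y) := Measure.isProbabilityMeasure_map hY.aemeasurable
  have : IsProbabilityMeasure (μ.map Z) := Measure.isProbabilityMeasure_map hZ.aemeasurable
  have e : ∫ ω, H (Y ω) (Z ω) ∂μ
      = ∫ p, Function.uncurry H p ∂(μ.map fun ω => (Y ω, Z ω)) := by
    rw [integral_map (hY.prodMk hZ).aemeasurable hH.aestronglyMeasurable]
    rfl
  have hi' : Integrable (Function.uncurry H) (μ.map fun ω => (Y ω, Z ω)) :=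
    (integrable_map_measure hH.aestronglyMeasurable (hY.prodMk hZ).aemeasurable).2 hi
  rw [hmap] at e hi'
  rw [e, integral_prod _ hi']
  refine integral_eq_zero_of_ae (Filter.Eventually.of_forall fun y => ?_)
  have hy : Measurable (H y) := hH.comp (measurable_const.prodMk measurable_id)
  change ∫ z, H y z ∂_ = 0
  rw [integral_map hZ.aemeasurable hy.aestronglyMeasurable]
  exact h0 y

/-- Unlike its Bochner counterpart it needs no integrability beforehand, so it serves to establish
integrability of the noise along the iterates. -/
theorem lintegral_le_of_indepFun (hY : Measurable Y) (hZ : Measurable Z)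
    (hYZ : IndepFun Y Z μ) {H : α → β → ℝ≥0∞} (hH : Measurable (Function.uncurry H))
    {k : α → ℝ≥0∞} (hk : ∀ y, ∫⁻ ω, H y (Z ω) ∂μ ≤ k y) :
    ∫⁻ ω, H (Y ω) (Z ω) ∂μ ≤ ∫⁻ ω, k (Y ω) ∂μ := by
  have hmap := (indepFun_iff_map_prod_eq_prod_map_map hY.aemeasurable hZ.aemeasurable).1 hYZ
  have : IsProbabilityMeasure (μ.map Y) := Measure.isProbabilityMeasure_map hY.aemeasurable
  have : IsProbabilityMeasure (μ.map Z) := Measure.isProbabilityMeasure_map hZ.aemeasurable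
  have e : ∫⁻ ω, H (Y ω) (Z ω) ∂μ
      = ∫⁻ p, Function.uncurry H p ∂(μ.map fun ω => (Y ω, Z ω)) := by
    rw [lintegral_map hH (hY.prodMk hZ)]
    rfl
  have hinner : Measurable fun y => ∫⁻ z, H y z ∂(μ.map Z) := hH.lintegral_prod_right'
  rw [e, hmap, lintegral_prod _ hH.aemeasurable]
  change ∫⁻ y, ∫⁻ z, H y z ∂_ ∂_ ≤ _
  rw [lintegral_map hinner hY]
  refine lintegral_mono fun ω => ?_
  have hy : Measurable (H (Y ω)) := hH.comp (measurable_const.prodMk measurable_id)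
  rw [lintegral_map hy hZ]
  exact hk _

end Decoupling

section Batch

variable {Ω Ξ W : Type*} [MeasurableSpace Ω] [MeasurableSpace Ξ] {μ : Measure Ω} {P : Measure Ξ}

theorem memLp_comp_of_map_eq [NormedAddCommGroup W] {u : Ξ → W} {Y : Ω → Ξ} (hY : Measurable Y)
    (hlaw : μ.map Y = P) (hu : MemLp u 2 P) : MemLp (fun ω => u (Y ω)) 2 μ := by
  rw [← hlaw] at hu
  exact hu.comp_of_map hY.aemeasurable

theorem integral_comp_of_map_eq [NormedAddCommGroup W] [NormedSpace ℝ W]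
    {Y : Ω → Ξ} (hY : Measurable Y) (hlaw : μ.map Y = P)
    {v : Ξ → W} (hv : AEStronglyMeasurable v P) : ∫ ω, v (Y ω) ∂μ = ∫ ξ, v ξ ∂P := by
  rw [← hlaw] at hv ⊢
  exact (integral_map hY.aemeasurable hv).symm

variable [NormedAddCommGroup W] [InnerProductSpace ℝ W]

theorem integrable_inner_of_memLp {f g : Ω → W} (hf : MemLp f 2 μ) (hg : MemLp g 2 μ) :
    Integrable (fun ω => inner ℝ (f ω) (g ω)) μ :=
  (hf.norm.integrable_mul hg.norm).mono' (hf.1.inner hg.1)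
    (Filter.Eventually.of_forall fun _ => norm_inner_le_norm _ _)

variable {S : ℕ} {X : Fin S → Ω → Ξ} {u : Ξ → W}

theorem memLp_batch_average (hX : ∀ i, Measurable (X i)) (hlaw : ∀ i, μ.map (X i) = P)
    (hu : MemLp u 2 P) : MemLp (fun ω => (S : ℝ)⁻¹ • ∑ i, u (X i ω)) 2 μ :=
  MemLp.const_smul (f := fun ω => ∑ i, u (X i ω))
    (memLp_finsetSum _ fun i _ => memLp_comp_of_map_eq (hX i) (hlaw i) hu) (S : ℝ)⁻¹

variable [IsProbabilityMeasure μ]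

theorem integral_batch_average (hX : ∀ i, Measurable (X i)) (hlaw : ∀ i, μ.map (X i) = P)
    (hu : MemLp u 2 P) (hu0 : ∫ ξ, u ξ ∂P = 0) :
    ∫ ω, (S : ℝ)⁻¹ • ∑ i, u (X i ω) ∂μ = 0 := by
  rw [integral_smul, integral_finsetSum _ fun i _ =>
    (memLp_comp_of_map_eq (hX i) (hlaw i) hu).integrable one_le_two]
  simp [integral_comp_of_map_eq (hX _) (hlaw _) hu.1, hu0]

variable [CompleteSpace W] [MeasurableSpace W] [BorelSpace W] [SecondCountableTopology W]

/-- Averaging over an independent batch divides the variance by the size of the batch. -/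
theorem integral_norm_batch_average_sq (hX : ∀ i, Measurable (X i))
    (hlaw : ∀ i, μ.map (X i) = P) (hind : Pairwise fun i j => IndepFun (X i) (X j) μ)
    (hum : Measurable u) (hu : MemLp u 2 P) (hu0 : ∫ ξ, u ξ ∂P = 0) :
    ∫ ω, ‖(S : ℝ)⁻¹ • ∑ i, u (X i ω)‖ ^ 2 ∂μ = (S : ℝ)⁻¹ * ∫ ξ, ‖u ξ‖ ^ 2 ∂P := by
  have hm : ∀ i, MemLp (fun ω => u (X i ω)) 2 μ := fun i =>
    memLp_comp_of_map_eq (hX i) (hlaw i) hu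
  have hin : ∀ i j, Integrable (fun ω => inner ℝ (u (X i ω)) (u (X j ω))) μ := fun i j =>
    integrable_inner_of_memLp (hm i) (hm j)
  have horth : ∀ i j, ∫ ω, inner ℝ (u (X i ω)) (u (X j ω)) ∂μ
      = if i = j then ∫ ξ, ‖u ξ‖ ^ 2 ∂P else 0 := fun i j => by
    split_ifs with hij
    · subst hij
      simp only [real_inner_self_eq_norm_sq]
      exact integral_comp_of_map_eq (v := fun ξ => ‖u ξ‖ ^ 2) (hX i) (hlaw i)
        (hu.1.norm.pow 2)
    · refine integral_eq_zero_of_indepFun (H := fun a b => inner ℝ (u a) (u b)) (hX i) (hX j)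
        (hind hij) ?_ (hin i j) fun y => ?_
      · exact (hum.comp measurable_fst).inner (hum.comp measurable_snd)
      · rw [integral_inner ((hm j).integrable one_le_two),
          integral_comp_of_map_eq (hX j) (hlaw j) hu.1, hu0, inner_zero_right]
  have e : ∀ ω, ‖(S : ℝ)⁻¹ • ∑ i, u (X i ω)‖ ^ 2
      = (S : ℝ)⁻¹ ^ 2 * ∑ i, ∑ j, inner ℝ (u (X i ω)) (u (X j ω)) := fun ω => by
    rw [norm_smul, mul_pow, ← real_inner_self_eq_norm_sq (∑ i, u (X i ω)), sum_inner]
    simp only [inner_sum, Real.norm_eq_abs, sq_abs]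
  simp only [e]
  rw [integral_const_mul, integral_finsetSum _ fun i _ => integrable_finsetSum _ fun j _ => hin i j]
  simp only [integral_finsetSum _ fun j _ => hin _ j, horth]
  rcases Nat.eq_zero_or_pos S with rfl | hS
  · simp
  · simp
    field_simp

end Batch

/-! ### Pathwise analysis of normalized descent with momentum. -/

section Deterministic

/-- The exponential moving average of a sequence, started at `0`. -/
def movingAverage {W : Type*} [NormedAddCommGroup W] [NormedSpace ℝ W] (β : ℝ) (x : ℕ → W) :
    ℕ → W
  | 0 => 0
  | t + 1 => β • movingAverage β x t + (1 - β) • x t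

theorem sum_add_le_of_contraction {β : ℝ} {x y : ℕ → ℝ} (h0 : x 0 = 0)
    (h : ∀ t, x (t + 1) ≤ β * x t + y t) (N : ℕ) :
    (1 - β) * ∑ t ∈ Finset.range N, x t + x N ≤ ∑ t ∈ Finset.range N, y t := by
  induction N with
  | zero => simp [h0]
  | succ N ih =>
    rw [Finset.sum_range_succ, Finset.sum_range_succ]
    linarith [h N]

variable {W : Type*} [NormedAddCommGroup W] [InnerProductSpace ℝ W]

/-- Each `x t` enters the later averages with geometric weights of total at most 1. -/
theorem sum_norm_movingAverage_succ_le {β : ℝ} (hβ0 : 0 ≤ β) (hβ1 : β < 1) (x : ℕ → W) (N : ℕ) :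
    ∑ t ∈ Finset.range N, ‖movingAverage β x (t + 1)‖ ≤ ∑ t ∈ Finset.range N, ‖x t‖ := by
  have hα : 0 < 1 - β := by linarith
  have h := sum_add_le_of_contraction (β := β) (x := fun t => ‖movingAverage β x t‖)
    (y := fun t => (1 - β) * ‖x t‖) (by simp [movingAverage]) (fun t => by
      refine (norm_add_le _ _).trans (le_of_eq ?_)
      rw [norm_smul, norm_smul, Real.norm_of_nonneg hβ0, Real.norm_of_nonneg hα.le]) N
  rw [← Finset.mul_sum] at h
  have h1 : ∑ t ∈ Finset.range N, ‖movingAverage β x (t + 1)‖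
      = ∑ t ∈ Finset.range N, ‖movingAverage β x t‖ + ‖movingAverage β x N‖ := by
    have := Finset.sum_range_succ' (fun t => ‖movingAverage β x t‖) N
    rw [Finset.sum_range_succ] at this
    simpa [movingAverage] using this.symm
  rw [h1]
  refine le_of_mul_le_mul_left (le_trans ?_ h) hα
  nlinarith [mul_nonneg hβ0 (norm_nonneg (movingAverage β x N))]

theorem norm_sub_normalized_le {γ : ℝ} (hγ : 0 ≤ γ) (w m : W) :
    ‖(w - (γ / ‖m‖) • m) - w‖ ≤ γ := by
  rw [sub_sub_cancel_left, norm_neg, norm_smul, norm_div, norm_norm, Real.norm_of_nonneg hγ]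
  rcases eq_or_ne ‖m‖ 0 with h | h
  · simp [h, hγ]
  · rw [div_mul_cancel₀ _ h]

/-- Since ⟨g, m⟩/‖m‖ ≥ ‖m‖ - ‖m - g‖ and ‖m‖ ≥ ‖g‖ - ‖m - g‖, an inexact direction costs twice its
error. For m = 0 there is no step and ‖m - g‖ = ‖g‖, so the bound still holds. -/
theorem inner_sub_normalized_le {γ : ℝ} (hγ : 0 ≤ γ) (w m g : W) :
    inner ℝ g ((w - (γ / ‖m‖) • m) - w) ≤ -γ * ‖g‖ + 2 * γ * ‖m - g‖ := by
  rw [sub_sub_cancel_left, inner_neg_right, real_inner_smul_right]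
  have h1 : ‖g‖ ≤ ‖m‖ + ‖m - g‖ := by
    have := norm_sub_le m (m - g)
    rwa [sub_sub_cancel] at this
  rcases eq_or_ne ‖m‖ 0 with h | h
  · rw [h] at h1
    simp only [h, div_zero, zero_mul, neg_zero]
    nlinarith [mul_le_mul_of_nonneg_left h1 hγ, mul_nonneg hγ (norm_nonneg (m - g))]
  · have hm : 0 < ‖m‖ := lt_of_le_of_ne (norm_nonneg m) h.symm
    have h2 : inner ℝ g m = ‖m‖ ^ 2 - inner ℝ (m - g) m := by
      rw [inner_sub_left, real_inner_self_eq_norm_sq]; ring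
    have h3 : inner ℝ (m - g) m ≤ ‖m - g‖ * ‖m‖ := real_inner_le_norm _ _
    have h4 : ‖m‖ - ‖m - g‖ ≤ inner ℝ g m / ‖m‖ := by
      rw [le_div_iff₀ hm]; nlinarith
    have h5 : γ / ‖m‖ * inner ℝ g m = γ * (inner ℝ g m / ‖m‖) := by ring
    rw [h5]
    nlinarith

/-- The pathwise bound for normalized momentum descent with noise `a + b` in the gradients. -/
theorem sum_norm_gradient_le {F : W → ℝ} {g : W → W} {K₀ K₁ γ β ε Δ : ℝ} {w m a b : ℕ → W}
    (hlip : ∀ w v, ‖g w - g v‖ ≤ (K₀ + K₁ * ‖g w‖) * ‖w - v‖)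
    (hdesc : ∀ w v, F v ≤ F w + inner ℝ (g w) (v - w) + (K₀ + K₁ * ‖g w‖) * ‖v - w‖ ^ 2)
    (hK₀ : 0 ≤ K₀) (hK₁ : 0 ≤ K₁) (hγ : 0 < γ) (hβ0 : 0 ≤ β) (hβ1 : β < 1)
    (hγ₀ : 24 * (γ * K₀) ≤ (1 - β) * ε) (hγ₁ : 24 * (γ * K₁) ≤ 1 - β)
    (hm0 : m 0 = g (w 0))
    (hm : ∀ t, m (t + 1) = β • m t + (1 - β) • (g (w t) + (a t + b t)))
    (hw : ∀ t, w (t + 1) = w t - (γ / ‖m (t + 1)‖) • m (t + 1)) (N : ℕ)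
    (hΔ : F (w 0) - F (w N) ≤ Δ) :
    7 / 8 * ∑ t ∈ Finset.range N, ‖g (w t)‖ ≤ Δ / γ + N * ε / 8
      + 2 * ∑ t ∈ Finset.range N, ‖b t‖
      + 2 * ∑ t ∈ Finset.range N, ‖movingAverage β a (t + 1)‖ := by
  have hα : 0 < 1 - β := by linarith
  set D : ℕ → ℝ := fun t => K₀ + K₁ * ‖g (w t)‖ with hD
  have hD0 : ∀ t, 0 ≤ D t := fun t => by positivity
  have hstep : ∀ t, ‖w (t + 1) - w t‖ ≤ γ := fun t => by
    rw [hw t]; exact norm_sub_normalized_le hγ.le _ _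
  -- The momentum error with both noise averages removed: only the drift of the gradient along the
  -- path remains. It starts at 0 because m₀ is the exact gradient.
  set E : ℕ → W := fun t => m t - g (w t) - movingAverage β a t - movingAverage β b t with hE
  have herr : ∀ t, m (t + 1) - g (w t)
      = β • E t + movingAverage β a (t + 1) + movingAverage β b (t + 1) := fun t => by
    simp only [hE, hm t, movingAverage]
    module
  have hEs : ∀ t, E (t + 1) = β • E t + (g (w t) - g (w (t + 1))) := fun t => by
    have := herr t
    simp only [hE] at this ⊢
    rw [sub_eq_iff_eq_add] at this
    rw [this]
    module
  have hEsum := sum_add_le_of_contraction (β := β) (x := fun t => ‖E t‖) (y := fun t => γ * D t)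
    (by simp [hE, hm0, movingAverage]) (fun t => by
      simp only [hEs t]
      refine (norm_add_le _ _).trans ?_
      rw [norm_smul, Real.norm_of_nonneg hβ0]
      refine add_le_add le_rfl ((hlip _ _).trans ?_)
      rw [norm_sub_rev, mul_comm]
      exact mul_le_mul_of_nonneg_right (hstep t) (hD0 t)) N
  have hBsum := sum_norm_movingAverage_succ_le hβ0 hβ1 b N
  have hone : ∀ t, F (w (t + 1)) ≤ F (w t) + (-γ * ‖g (w t)‖
      + 2 * γ * (‖E t‖ + ‖movingAverage β a (t + 1)‖ + ‖movingAverage β b (t + 1)‖)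
      + γ ^ 2 * D t) := fun t => by
    have h1 := hdesc (w t) (w (t + 1))
    have h2 : inner ℝ (g (w t)) (w (t + 1) - w t)
        ≤ -γ * ‖g (w t)‖ + 2 * γ * ‖m (t + 1) - g (w t)‖ := by
      rw [hw t]; exact inner_sub_normalized_le hγ.le _ _ _
    have h3 : ‖m (t + 1) - g (w t)‖
        ≤ ‖E t‖ + ‖movingAverage β a (t + 1)‖ + ‖movingAverage β b (t + 1)‖ := by
      rw [herr t]
      refine (norm_add₃_le).trans ?_
      gcongr
      rw [norm_smul, Real.norm_of_nonneg hβ0]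
      exact mul_le_of_le_one_left (norm_nonneg _) hβ1.le
    have h4 : D t * ‖w (t + 1) - w t‖ ^ 2 ≤ D t * γ ^ 2 :=
      mul_le_mul_of_nonneg_left (pow_le_pow_left₀ (norm_nonneg _) (hstep t) 2) (hD0 t)
    have h5 := mul_le_mul_of_nonneg_left h3 (by positivity : 0 ≤ 2 * γ)
    simp only [hD] at h4 ⊢
    linarith
  have htel : ∀ n, F (w n) ≤ F (w 0) + ∑ t ∈ Finset.range n, (-γ * ‖g (w t)‖
      + 2 * γ * (‖E t‖ + ‖movingAverage β a (t + 1)‖ + ‖movingAverage β b (t + 1)‖)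
      + γ ^ 2 * D t) := fun n => by
    induction n with
    | zero => simp
    | succ n ih =>
      rw [Finset.sum_range_succ]
      linarith [hone n]
  have hN := htel N
  simp only [Finset.sum_add_distrib, ← Finset.mul_sum] at hN
  set sg := ∑ t ∈ Finset.range N, ‖g (w t)‖
  set sE := ∑ t ∈ Finset.range N, ‖E t‖
  set sa := ∑ t ∈ Finset.range N, ‖movingAverage β a (t + 1)‖
  set sB := ∑ t ∈ Finset.range N, ‖movingAverage β b (t + 1)‖
  set sb := ∑ t ∈ Finset.range N, ‖b t‖
  set sD := ∑ t ∈ Finset.range N, D t with hsD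
  have hsD' : sD = N * K₀ + K₁ * sg := by
    simp [hsD, hD, Finset.sum_add_distrib, ← Finset.mul_sum, sg]
  have hsg : 0 ≤ sg := Finset.sum_nonneg fun _ _ => norm_nonneg _
  have hsD0 : 0 ≤ sD := Finset.sum_nonneg fun t _ => hD0 t
  -- The factor 24 is chosen so that 2·sE + γ·sD is at most (2 + 1)/24 = 1/8 of Nε + sg, which
  -- leaves 7/8 of sg on the left.
  have hγD : 24 * (γ * sD) ≤ (1 - β) * (N * ε + sg) := by
    rw [hsD']
    have h1 := mul_le_mul_of_nonneg_left hγ₀ (Nat.cast_nonneg (α := ℝ) N)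
    have h2 := mul_le_mul_of_nonneg_right hγ₁ hsg
    linarith
  have hEsum' : (1 - β) * sE ≤ γ * sD := by
    rw [← Finset.mul_sum] at hEsum
    linarith [norm_nonneg (E N)]
  have hsE : 24 * sE ≤ N * ε + sg :=
    le_of_mul_le_mul_left (by linarith) hα
  have hγD' : 24 * (γ * sD) ≤ N * ε + sg := by
    have h0 : 0 ≤ N * ε + sg := by
      by_contra! hneg
      have := mul_neg_of_pos_of_neg hα hneg
      have := mul_nonneg hγ.le hsD0
      linarith
    nlinarith [mul_nonneg hβ0 h0]
  have hmain : γ * sg ≤ Δ + γ * (2 * (sE + sa + sB) + γ * sD) := by linarith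
  have : sg ≤ Δ / γ + (2 * (sE + sa + sB) + γ * sD) := by
    rw [← sub_le_iff_le_add, le_div_iff₀ hγ]
    linarith
  linarith

end Deterministic
end DRO

/-! ### Splitting the noise at the level Λ. -/

namespace DRO

section Noise

variable {W Ξ : Type*} [NormedAddCommGroup W] [InnerProductSpace ℝ W]

/-- The noise of the mini-batch gradient. -/
noncomputable def batchNoise (gf : W → Ξ → W) (g : W → W) {S : ℕ} (w : W) (z : Fin S → Ξ) : W :=
  (S : ℝ)⁻¹ • ∑ i, (gf w (z i) - g w)

open Classical in
/-- The noise at points where the gradient is at most the noise level `Λ`. -/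
noncomputable def smallNoise (gf : W → Ξ → W) (g : W → W) (Λ : ℝ) {S : ℕ} (w : W)
    (z : Fin S → Ξ) : W :=
  if ‖g w‖ ≤ Λ then batchNoise gf g w z else 0

open Classical in
/-- The noise at points where the gradient exceeds the noise level `Λ`. -/
noncomputable def largeNoise (gf : W → Ξ → W) (g : W → W) (Λ : ℝ) {S : ℕ} (w : W)
    (z : Fin S → Ξ) : W :=
  if ‖g w‖ ≤ Λ then 0 else batchNoise gf g w z

theorem small_add_largeNoise (gf : W → Ξ → W) (g : W → W) (Λ : ℝ) {S : ℕ} (w : W)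
    (z : Fin S → Ξ) : smallNoise gf g Λ w z + largeNoise gf g Λ w z = batchNoise gf g w z := by
  unfold smallNoise largeNoise
  split_ifs <;> simp

theorem measurable_movingAverage [MeasurableSpace W] [BorelSpace W] [SecondCountableTopology W]
    {Ω : Type*} {mΩ : MeasurableSpace Ω} {β : ℝ} {x : ℕ → Ω → W}
    (n : ℕ) (hx : ∀ t < n, Measurable (x t)) :
    Measurable fun ω => movingAverage β (fun t => x t ω) n := by
  induction n with
  | zero => exact measurable_const
  | succ n ih =>
    exact ((ih fun t ht => hx t (by omega)).const_smul β).add ((hx n (by omega)).const_smul _)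

end Noise

section Stochastic

variable {W Ξ : Type*} [NormedAddCommGroup W] [InnerProductSpace ℝ W] [CompleteSpace W]
  [MeasurableSpace W] [MeasurableSpace Ξ]

/-- A stochastic objective `f` whose expectation `F` has gradient `g`, with smoothness constant and
noise level growing with the norm of the gradient. -/
structure IsStochasticObjective (P : Measure Ξ) (f : W → Ξ → ℝ) (F : W → ℝ) (gf : W → Ξ → W)
    (g : W → W) (K₀ K₁ Λ : ℝ) : Prop where
  K₀_nonneg : 0 ≤ K₀
  K₁_nonneg : 0 ≤ K₁
  Λ_nonneg : 0 ≤ Λ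
  gradient_eq : ∀ w ξ, gradient (fun v => f v ξ) w = gf w ξ
  measurable : Measurable (Function.uncurry gf)
  memLp : ∀ w, MemLp (gf w) 2 P
  mean : ∀ w, ∫ ξ, gf w ξ ∂P = g w
  noise : ∀ w, ∫ ξ, ‖gf w ξ - g w‖ ^ 2 ∂P ≤ Λ ^ 2 + 2 * ‖g w‖ ^ 2
  lip : ∀ w v, ‖g w - g v‖ ≤ (K₀ + K₁ * ‖g w‖) * ‖w - v‖
  desc : ∀ w v, F v ≤ F w + inner ℝ (g w) (v - w) + (K₀ + K₁ * ‖g w‖) * ‖v - w‖ ^ 2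

namespace IsStochasticObjective

variable {P : Measure Ξ} {f : W → Ξ → ℝ} {F : W → ℝ} {gf : W → Ξ → W} {g : W → W} {K₀ K₁ Λ : ℝ}
  (h : IsStochasticObjective P f F gf g K₀ K₁ Λ)
include h

theorem batchGradient_eq {S : ℕ} (z : Fin S → Ξ) (w : W) :
    batchGradient f z w = (S : ℝ)⁻¹ • ∑ i, gf w (z i) := by
  simp only [batchGradient, h.gradient_eq]

theorem batchGradient_eq_add {S : ℕ} (hS : 0 < S) (Λ' : ℝ) (z : Fin S → Ξ) (w : W) :
    batchGradient f z w = g w + (smallNoise gf g Λ' w z + largeNoise gf g Λ' w z) := by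
  have : (S : ℝ) ≠ 0 := by positivity
  rw [small_add_largeNoise, h.batchGradient_eq, batchNoise, Finset.sum_sub_distrib, smul_sub]
  simp only [Finset.sum_const, Finset.card_univ, Fintype.card_fin, ← Nat.cast_smul_eq_nsmul ℝ,
    smul_smul, inv_mul_cancel₀ this, one_smul]
  abel

theorem memLp_sub [IsProbabilityMeasure P] (w : W) : MemLp (fun ξ => gf w ξ - g w) 2 P :=
  (h.memLp w).sub (memLp_const _)

theorem integral_gf_sub [IsProbabilityMeasure P] (w : W) : ∫ ξ, (gf w ξ - g w) ∂P = 0 := by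
  rw [integral_sub ((h.memLp w).integrable one_le_two) (integrable_const _), h.mean]
  simp

section FixedPoint

variable [IsProbabilityMeasure P] {Ω : Type*} [MeasurableSpace Ω] {μ : Measure Ω} {S : ℕ}
  {X : Fin S → Ω → Ξ}

theorem memLp_batchNoise (hX : ∀ i, Measurable (X i)) (hlaw : ∀ i, μ.map (X i) = P) (w : W) :
    MemLp (fun ω => batchNoise gf g w fun i => X i ω) 2 μ :=
  memLp_batch_average hX hlaw (h.memLp_sub w)

theorem memLp_smallNoise (hX : ∀ i, Measurable (X i)) (hlaw : ∀ i, μ.map (X i) = P) (w : W) :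
    MemLp (fun ω => smallNoise gf g Λ w fun i => X i ω) 2 μ := by
  unfold smallNoise
  split_ifs
  · exact h.memLp_batchNoise hX hlaw w
  · exact MemLp.zero'

variable [IsProbabilityMeasure μ]

theorem integral_batchNoise (hX : ∀ i, Measurable (X i)) (hlaw : ∀ i, μ.map (X i) = P) (w : W) :
    ∫ ω, batchNoise gf g w (fun i => X i ω) ∂μ = 0 :=
  integral_batch_average hX hlaw (h.memLp_sub w) (h.integral_gf_sub w)

theorem integral_smallNoise (hX : ∀ i, Measurable (X i)) (hlaw : ∀ i, μ.map (X i) = P) (w : W) :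
    ∫ ω, smallNoise gf g Λ w (fun i => X i ω) ∂μ = 0 := by
  unfold smallNoise
  split_ifs
  · exact h.integral_batchNoise hX hlaw w
  · simp

end FixedPoint

theorem measurable_gf_comp {Ω : Type*} {mΩ : MeasurableSpace Ω} {Y : Ω → W} {Z : Ω → Ξ}
    (hY : Measurable Y) (hZ : Measurable Z) : Measurable fun ω => gf (Y ω) (Z ω) :=
  h.measurable.comp (hY.prodMk hZ)

theorem continuous_g : Continuous g := by
  rw [continuous_iff_continuousAt]
  intro w
  rw [ContinuousAt, tendsto_iff_norm_sub_tendsto_zero]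
  simp only [norm_sub_rev _ (g w)]
  refine squeeze_zero (fun _ => norm_nonneg _) (fun v => h.lip w v) ?_
  have : Continuous fun v => (K₀ + K₁ * ‖g w‖) * ‖w - v‖ := by fun_prop
  simpa using this.tendsto w

variable [BorelSpace W] [SecondCountableTopology W]

theorem measurable_batchNoise {S : ℕ} :
    Measurable (Function.uncurry (batchNoise gf g (S := S))) := by
  refine Measurable.const_smul (Finset.measurable_fun_sum _ fun i _ => ?_) _
  exact (h.measurable_gf_comp measurable_fst ((measurable_pi_apply i).comp measurable_snd)).sub
    (h.continuous_g.measurable.comp measurable_fst)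

theorem measurable_smallNoise {S : ℕ} (Λ' : ℝ) :
    Measurable (Function.uncurry (smallNoise gf g Λ' (S := S))) :=
  Measurable.ite (measurableSet_le (h.continuous_g.measurable.comp measurable_fst).norm
    measurable_const) h.measurable_batchNoise measurable_const

theorem measurable_largeNoise {S : ℕ} (Λ' : ℝ) :
    Measurable (Function.uncurry (largeNoise gf g Λ' (S := S))) :=
  Measurable.ite (measurableSet_le (h.continuous_g.measurable.comp measurable_fst).norm
    measurable_const) measurable_const h.measurable_batchNoise

/-- The σ-algebra on Ω is left free and only batches before time `n` must be measurable, so the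
lemma also applies to the σ-algebra of the past. -/
theorem measurable_snm {Ω : Type*} {mΩ : MeasurableSpace Ω} {S : ℕ} {sample : ℕ → Fin S → Ω → Ξ}
    (w₀ m₀ : W) (γ β : ℝ) (n : ℕ) (hs : ∀ t < n, ∀ i, Measurable (sample t i)) :
    Measurable (fun ω => (snm f w₀ m₀ γ β (fun t i => sample t i ω) n).point) ∧
    Measurable (fun ω => (snm f w₀ m₀ γ β (fun t i => sample t i ω) n).momentum) := by
  induction n with
  | zero => exact ⟨measurable_const, measurable_const⟩
  | succ n ih =>
    obtain ⟨hp, hm⟩ := ih fun t ht => hs t (by omega)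
    have hm' : Measurable
        (fun ω => (snm f w₀ m₀ γ β (fun t i => sample t i ω) (n + 1)).momentum) := by
      simp only [snm, snmStep, h.batchGradient_eq]
      refine (hm.const_smul β).add (Measurable.const_smul (Measurable.const_smul
        (Finset.measurable_fun_sum _ fun i _ => ?_) _) _)
      exact h.measurable_gf_comp hp (hs n (by omega) i)
    refine ⟨?_, hm'⟩
    exact hp.sub ((measurable_const.div hm'.norm).smul hm')

section Noise

variable [IsProbabilityMeasure P] {Ω : Type*} [MeasurableSpace Ω] {μ : Measure Ω}
  [IsProbabilityMeasure μ] {S : ℕ} {X : Fin S → Ω → Ξ}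

theorem integral_norm_batchNoise_sq_le (hX : ∀ i, Measurable (X i))
    (hlaw : ∀ i, μ.map (X i) = P) (hind : Pairwise fun i j => IndepFun (X i) (X j) μ) (w : W) :
    ∫ ω, ‖batchNoise gf g w fun i => X i ω‖ ^ 2 ∂μ
      ≤ (S : ℝ)⁻¹ * (Λ ^ 2 + 2 * ‖g w‖ ^ 2) := by
  have hm : Measurable fun ξ => gf w ξ - g w :=
    (h.measurable_gf_comp measurable_const measurable_id).sub_const _
  refine (integral_norm_batch_average_sq hX hlaw hind hm (h.memLp_sub w)
    (h.integral_gf_sub w)).le.trans ?_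
  exact mul_le_mul_of_nonneg_left (h.noise w) (by positivity)

theorem lintegral_smallNoise_sq_le (hX : ∀ i, Measurable (X i))
    (hlaw : ∀ i, μ.map (X i) = P) (hind : Pairwise fun i j => IndepFun (X i) (X j) μ) (w : W) :
    ∫⁻ ω, ENNReal.ofReal (‖smallNoise gf g Λ w fun i => X i ω‖ ^ 2) ∂μ
      ≤ ENNReal.ofReal ((S : ℝ)⁻¹ * (3 * Λ ^ 2)) := by
  rw [← ofReal_integral_eq_lintegral_ofReal (h.memLp_smallNoise hX hlaw w).norm.integrable_sq
    (Filter.Eventually.of_forall fun _ => sq_nonneg _)]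
  refine ENNReal.ofReal_le_ofReal ?_
  unfold smallNoise
  split_ifs with hw
  · refine (h.integral_norm_batchNoise_sq_le hX hlaw hind w).trans ?_
    have := pow_le_pow_left₀ (norm_nonneg _) hw 2
    exact mul_le_mul_of_nonneg_left (by linarith) (by positivity)
  · simp; positivity

/-- Above the level Λ the variance is at most 3‖g w‖²/S, and 768 = 3·16² makes its square root at
most ‖g w‖/16. -/
theorem lintegral_largeNoise_le (hX : ∀ i, Measurable (X i))
    (hlaw : ∀ i, μ.map (X i) = P) (hind : Pairwise fun i j => IndepFun (X i) (X j) μ)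
    (hS : 768 ≤ S) (w : W) :
    ∫⁻ ω, ENNReal.ofReal ‖largeNoise gf g Λ w fun i => X i ω‖ ∂μ
      ≤ ENNReal.ofReal (‖g w‖ / 16) := by
  unfold largeNoise
  split_ifs with hw
  · simp
  · have hm := h.memLp_batchNoise hX hlaw w (μ := μ)
    rw [← ofReal_integral_eq_lintegral_ofReal (hm.integrable one_le_two).norm
      (Filter.Eventually.of_forall fun _ => norm_nonneg _)]
    refine ENNReal.ofReal_le_ofReal (abs_le_of_sq_le_sq' ?_ (by positivity) |>.2)
    have h1 := sq_integral_norm_le hm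
    have h3 := h.integral_norm_batchNoise_sq_le hX hlaw hind w
    have h4 : Λ ^ 2 ≤ ‖g w‖ ^ 2 := pow_le_pow_left₀ h.Λ_nonneg (not_le.1 hw).le 2
    have h5 : (S : ℝ)⁻¹ ≤ 1 / 768 := by
      rw [inv_eq_one_div]
      exact one_div_le_one_div_of_le (by norm_num) (by exact_mod_cast hS)
    have h6 : (S : ℝ)⁻¹ * (Λ ^ 2 + 2 * ‖g w‖ ^ 2) ≤ 1 / 768 * (3 * ‖g w‖ ^ 2) :=
      mul_le_mul h5 (by linarith) (by positivity) (by norm_num)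
    calc _ ≤ 1 / 768 * (3 * ‖g w‖ ^ 2) := by linarith
      _ = _ := by ring

end Noise

end IsStochasticObjective
end Stochastic
end DRO

/-! ### Noise along the random iterates and convergence in expectation. -/

namespace DRO

section Past

variable {Ω Ξ α : Type*} [MeasurableSpace Ξ] {S : ℕ} {sample : ℕ → Fin S → Ω → Ξ}

/-- The σ-algebra of the batches drawn before time `t`. -/
abbrev pastSigma (sample : ℕ → Fin S → Ω → Ξ) (t : ℕ) : MeasurableSpace Ω :=
  ⨆ p ∈ {p : ℕ × Fin S | p.1 < t}, MeasurableSpace.comap (sample p.1 p.2) inferInstance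

theorem measurable_pastSigma {s t : ℕ} (hst : s < t) (i : Fin S) :
    Measurable[pastSigma sample t] (sample s i) := by
  rw [measurable_iff_comap_le]
  exact le_iSup₂_of_le (f := fun (p : ℕ × Fin S) (_ : p ∈ {p : ℕ × Fin S | p.1 < t}) =>
    MeasurableSpace.comap (sample p.1 p.2) inferInstance) (s, i) hst le_rfl

variable [MeasurableSpace Ω] [MeasurableSpace α] {μ : Measure Ω} {P : Measure Ξ}

theorem IsIIDSample.pastSigma_le (h : IsIIDSample μ P sample) (t : ℕ) :
    pastSigma sample t ≤ ‹MeasurableSpace Ω› :=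
  iSup₂_le fun p _ => (h.measurable p.1 p.2).comap_le

/-- Disjoint index sets of an independent family generate independent σ-algebras; the current batch
is thus fresh relative to the iterate it is evaluated at. -/
theorem IsIIDSample.indepFun_past (h : IsIIDSample μ P sample) {t : ℕ} {Y : Ω → α}
    (hY : Measurable[pastSigma sample t] Y) : IndepFun Y (fun ω i => sample t i ω) μ := by
  have hind := indep_iSup_of_disjoint (fun p : ℕ × Fin S => (h.measurable p.1 p.2).comap_le)
    h.indep (S := {p | p.1 < t}) (T := {p | p.1 = t})
    (Set.disjoint_left.2 fun p hp hq => (ne_of_lt hp) hq)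
  refine indep_of_indep_of_le_right (indep_of_indep_of_le_left hind hY.comap_le) ?_
  refine Measurable.comap_le ?_
  refine @measurable_pi_lambda _ _ _ (_) _ _ fun i => ?_
  rw [measurable_iff_comap_le]
  exact le_iSup₂_of_le (f := fun (p : ℕ × Fin S) (_ : p ∈ {p : ℕ × Fin S | p.1 = t}) =>
    MeasurableSpace.comap (sample p.1 p.2) inferInstance) (t, i) rfl le_rfl

theorem IsIIDSample.pairwise_indepFun (h : IsIIDSample μ P sample) (t : ℕ) :
    Pairwise fun i j => IndepFun (sample t i) (sample t j) μ := fun i j hij =>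
  h.indep.indepFun (i := (t, i)) (j := (t, j)) fun e => hij (Prod.ext_iff.1 e).2

end Past

section Iterates

variable {W Ξ Ω : Type*} [NormedAddCommGroup W] [InnerProductSpace ℝ W] [CompleteSpace W]
  {f : W → Ξ → ℝ} {g : W → W} {S : ℕ} {sample : ℕ → Fin S → Ω → Ξ}

/-- The iterates of SNM started at `w₀` with momentum `g w₀`. -/
noncomputable def snmPoint (f : W → Ξ → ℝ) (g : W → W) (w₀ : W) (γ β : ℝ)
    (sample : ℕ → Fin S → Ω → Ξ) (t : ℕ) (ω : Ω) : W :=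
  (snm f w₀ (g w₀) γ β (fun t i => sample t i ω) t).point

theorem norm_snmPoint_succ_sub_le {w₀ : W} {γ β : ℝ} (hγ : 0 ≤ γ) (t : ℕ) (ω : Ω) :
    ‖snmPoint f g w₀ γ β sample (t + 1) ω - snmPoint f g w₀ γ β sample t ω‖ ≤ γ :=
  norm_sub_normalized_le hγ _ _

variable [MeasurableSpace W] [MeasurableSpace Ξ] {P : Measure Ξ} {F : W → ℝ}
  {gf : W → Ξ → W} {K₀ K₁ Λ : ℝ}

namespace IsStochasticObjective

variable (h : IsStochasticObjective P f F gf g K₀ K₁ Λ)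
include h

/-- Steps have length at most γ, so the gradient can grow only by a deterministic amount per step.
The constant depends on `t` and serves only for integrability. -/
theorem exists_norm_g_snmPoint_le (w₀ : W) {γ β : ℝ} (hγ : 0 ≤ γ) (t : ℕ) :
    ∃ C, ∀ ω, ‖g (snmPoint f g w₀ γ β sample t ω)‖ ≤ C := by
  induction t with
  | zero => exact ⟨‖g w₀‖, fun ω => le_rfl⟩
  | succ t ih =>
    obtain ⟨C, hC⟩ := ih
    refine ⟨C + (K₀ + K₁ * C) * γ, fun ω => ?_⟩
    set w := snmPoint f g w₀ γ β sample t ω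
    set w' := snmPoint f g w₀ γ β sample (t + 1) ω
    have h1 : ‖g w'‖ ≤ ‖g w‖ + ‖g w - g w'‖ := by
      have := norm_sub_le (g w) (g w - g w')
      rwa [sub_sub_cancel] at this
    have h2 : ‖w - w'‖ ≤ γ := by
      rw [norm_sub_rev]; exact norm_snmPoint_succ_sub_le hγ t ω
    have h3 : (K₀ + K₁ * ‖g w‖) * ‖w - w'‖ ≤ (K₀ + K₁ * C) * γ := by
      have := h.K₀_nonneg
      have := h.K₁_nonneg
      have hC0 : 0 ≤ C := (norm_nonneg _).trans (hC ω)
      have := mul_le_mul_of_nonneg_left (hC ω) h.K₁_nonneg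
      exact mul_le_mul (by linarith) h2 (norm_nonneg _) (by positivity)
    linarith [hC ω, h.lip w w']

variable [BorelSpace W] [SecondCountableTopology W]

theorem measurable_past_snmPoint (w₀ : W) (γ β : ℝ) (t : ℕ) :
    Measurable[pastSigma sample t] (snmPoint f g w₀ γ β sample t) :=
  (h.measurable_snm (mΩ := pastSigma sample t) w₀ (g w₀) γ β t
    fun _ hs i => measurable_pastSigma hs i).1

theorem measurable_past_movingAverage (w₀ : W) (γ β : ℝ) (t : ℕ) :
    Measurable[pastSigma sample t] fun ω => movingAverage β (fun s =>
      smallNoise gf g Λ (snmPoint f g w₀ γ β sample s ω) fun i => sample s i ω) t := by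
  refine measurable_movingAverage (mΩ := pastSigma sample t) t fun s hst => ?_
  refine (h.measurable_smallNoise Λ).comp (Measurable.prodMk ?_
    (@measurable_pi_lambda _ _ _ (_) _ _ fun i => measurable_pastSigma hst i))
  exact (h.measurable_snm (mΩ := pastSigma sample t) w₀ (g w₀) γ β s
    fun r hr i => measurable_pastSigma (hr.trans hst) i).1

variable [MeasurableSpace Ω] {μ : Measure Ω}

theorem measurable_snmPoint (hs : IsIIDSample μ P sample) (w₀ : W) (γ β : ℝ) (t : ℕ) :
    Measurable (snmPoint f g w₀ γ β sample t) :=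
  (h.measurable_snm w₀ (g w₀) γ β t fun s _ i => hs.measurable s i).1

theorem measurable_smallNoise_snm (hs : IsIIDSample μ P sample) (w₀ : W) (γ β : ℝ) (t : ℕ) :
    Measurable fun ω => smallNoise gf g Λ (snmPoint f g w₀ γ β sample t ω)
      fun i => sample t i ω :=
  (h.measurable_smallNoise Λ).comp ((h.measurable_snmPoint hs w₀ γ β t).prodMk
    (measurable_pi_lambda _ fun i => hs.measurable t i))

theorem measurable_largeNoise_snm (hs : IsIIDSample μ P sample) (w₀ : W) (γ β : ℝ) (t : ℕ) :
    Measurable fun ω => largeNoise gf g Λ (snmPoint f g w₀ γ β sample t ω)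
      fun i => sample t i ω :=
  (h.measurable_largeNoise Λ).comp ((h.measurable_snmPoint hs w₀ γ β t).prodMk
    (measurable_pi_lambda _ fun i => hs.measurable t i))

variable [IsProbabilityMeasure μ]

theorem integrable_g_snmPoint (hs : IsIIDSample μ P sample) (w₀ : W) {γ : ℝ} (hγ : 0 ≤ γ) (β : ℝ)
    (t : ℕ) : Integrable (fun ω => ‖g (snmPoint f g w₀ γ β sample t ω)‖) μ := by
  obtain ⟨C, hC⟩ := h.exists_norm_g_snmPoint_le (sample := sample) (β := β) w₀ hγ t
  refine (integrable_const C).mono' (h.continuous_g.measurable.comp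
    (h.measurable_snmPoint hs w₀ γ β t)).norm.aestronglyMeasurable
    (Filter.Eventually.of_forall fun ω => ?_)
  simpa using hC ω

variable [IsProbabilityMeasure P]

theorem largeNoise_snm (hs : IsIIDSample μ P sample) (hS : 768 ≤ S) (w₀ : W) {γ : ℝ} (hγ : 0 ≤ γ)
    (β : ℝ) (t : ℕ) :
    Integrable (fun ω => ‖largeNoise gf g Λ (snmPoint f g w₀ γ β sample t ω)
      fun i => sample t i ω‖) μ ∧
    ∫ ω, ‖largeNoise gf g Λ (snmPoint f g w₀ γ β sample t ω) fun i => sample t i ω‖ ∂μ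
      ≤ (∫ ω, ‖g (snmPoint f g w₀ γ β sample t ω)‖ ∂μ) / 16 := by
  have hm := h.measurable_largeNoise_snm hs w₀ γ β t
  have hg := h.integrable_g_snmPoint hs w₀ hγ β t
  have hle := lintegral_le_of_indepFun (μ := μ) (h.measurable_snmPoint hs w₀ γ β t)
    (measurable_pi_lambda _ fun i => hs.measurable t i)
    (hs.indepFun_past (h.measurable_past_snmPoint w₀ γ β t))
    (H := fun w z => ENNReal.ofReal ‖largeNoise gf g Λ w z‖)
    (h.measurable_largeNoise Λ).norm.ennreal_ofReal
    (fun w => h.lintegral_largeNoise_le (hs.measurable t) (hs.law t) (hs.pairwise_indepFun t) hS w)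
  have hg16 : Integrable (fun ω => ‖g (snmPoint f g w₀ γ β sample t ω)‖ / 16) μ := hg.div_const 16
  rw [← ofReal_integral_eq_lintegral_ofReal hg16
    (Filter.Eventually.of_forall fun ω => by positivity), integral_div] at hle
  have hnn : 0 ≤ (∫ ω, ‖g (snmPoint f g w₀ γ β sample t ω)‖ ∂μ) / 16 :=
    div_nonneg (integral_nonneg fun _ => norm_nonneg _) (by norm_num)
  refine ⟨⟨hm.norm.aestronglyMeasurable, ?_⟩, ?_⟩
  · rw [hasFiniteIntegral_iff_ofReal (Filter.Eventually.of_forall fun _ => norm_nonneg _)]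
    exact hle.trans_lt ENNReal.ofReal_lt_top
  · rw [integral_eq_lintegral_of_nonneg_ae (Filter.Eventually.of_forall fun _ => norm_nonneg _)
      hm.norm.aestronglyMeasurable]
    exact ENNReal.toReal_le_of_le_ofReal hnn hle

theorem smallNoise_snm (hs : IsIIDSample μ P sample) (w₀ : W) (γ β : ℝ) (t : ℕ) :
    MemLp (fun ω => smallNoise gf g Λ (snmPoint f g w₀ γ β sample t ω)
      fun i => sample t i ω) 2 μ ∧
    ∫ ω, ‖smallNoise gf g Λ (snmPoint f g w₀ γ β sample t ω) fun i => sample t i ω‖ ^ 2 ∂μ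
      ≤ (S : ℝ)⁻¹ * (3 * Λ ^ 2) := by
  have hm := h.measurable_smallNoise_snm hs w₀ γ β t
  have hle := lintegral_le_of_indepFun (μ := μ) (h.measurable_snmPoint hs w₀ γ β t)
    (measurable_pi_lambda _ fun i => hs.measurable t i)
    (hs.indepFun_past (h.measurable_past_snmPoint w₀ γ β t))
    (H := fun w z => ENNReal.ofReal (‖smallNoise gf g Λ w z‖ ^ 2))
    ((h.measurable_smallNoise Λ).norm.pow_const 2).ennreal_ofReal
    (fun w => h.lintegral_smallNoise_sq_le (hs.measurable t) (hs.law t) (hs.pairwise_indepFun t) w)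
  rw [lintegral_const, measure_univ, mul_one] at hle
  refine ⟨?_, ?_⟩
  · rw [memLp_two_iff_integrable_sq_norm hm.aestronglyMeasurable]
    refine ⟨(hm.norm.pow_const 2).aestronglyMeasurable, ?_⟩
    rw [hasFiniteIntegral_iff_ofReal (Filter.Eventually.of_forall fun _ => sq_nonneg _)]
    exact hle.trans_lt ENNReal.ofReal_lt_top
  · rw [integral_eq_lintegral_of_nonneg_ae (Filter.Eventually.of_forall fun _ => sq_nonneg _)
      (hm.norm.pow_const 2).aestronglyMeasurable]
    exact ENNReal.toReal_le_of_le_ofReal (by positivity) hle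

/-- Each small noise has mean zero given the past, hence is orthogonal to the current average. The
second moment obeys x ↦ β²x + (1 - β)²v, which preserves x ≤ (1 - β)v since β² + (1 - β) ≤ 1. -/
theorem movingAverage_snm (hs : IsIIDSample μ P sample) (w₀ : W) (γ : ℝ) {β : ℝ} (hβ0 : 0 ≤ β)
    (hβ1 : β < 1) (t : ℕ) :
    MemLp (fun ω => movingAverage β (fun s =>
      smallNoise gf g Λ (snmPoint f g w₀ γ β sample s ω) fun i => sample s i ω) t) 2 μ ∧
    ∫ ω, ‖movingAverage β (fun s =>
      smallNoise gf g Λ (snmPoint f g w₀ γ β sample s ω) fun i => sample s i ω) t‖ ^ 2 ∂μ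
      ≤ (1 - β) * ((S : ℝ)⁻¹ * (3 * Λ ^ 2)) := by
  set v := (S : ℝ)⁻¹ * (3 * Λ ^ 2) with hv
  have hv0 : 0 ≤ v := by positivity
  induction t with
  | zero =>
    refine ⟨by simp [movingAverage], ?_⟩
    simp only [movingAverage, norm_zero]
    have := mul_nonneg (sub_nonneg.2 hβ1.le) hv0
    simpa using this
  | succ t ih =>
    obtain ⟨hA, hAle⟩ := ih
    obtain ⟨ha, hale⟩ := h.smallNoise_snm hs w₀ γ β t
    set A : Ω → W := fun ω => movingAverage β (fun s =>
      smallNoise gf g Λ (snmPoint f g w₀ γ β sample s ω) fun i => sample s i ω) t with hAdef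
    set a : Ω → W := fun ω => smallNoise gf g Λ (snmPoint f g w₀ γ β sample t ω)
      fun i => sample t i ω with hadef
    have hApast : Measurable[pastSigma sample t] A := h.measurable_past_movingAverage w₀ γ β t
    have hYpast : Measurable[pastSigma sample t]
        (fun ω => (A ω, snmPoint f g w₀ γ β sample t ω)) :=
      hApast.prodMk (h.measurable_past_snmPoint w₀ γ β t)
    have hin : Integrable (fun ω => inner ℝ (A ω) (a ω)) μ := integrable_inner_of_memLp hA ha
    have horth : ∫ ω, inner ℝ (A ω) (a ω) ∂μ = 0 := by
      refine integral_eq_zero_of_indepFun (hYpast.mono (hs.pastSigma_le t) le_rfl)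
        (measurable_pi_lambda _ fun i => hs.measurable t i) (hs.indepFun_past hYpast)
        (H := fun y z => inner ℝ y.1 (smallNoise gf g Λ y.2 z)) ?_ hin fun y => ?_
      · exact (measurable_fst.comp measurable_fst).inner ((h.measurable_smallNoise Λ).comp
          ((measurable_snd.comp measurable_fst).prodMk measurable_snd))
      · rw [integral_inner ((h.memLp_smallNoise (hs.measurable t) (hs.law t) y.2).integrable
          one_le_two), h.integral_smallNoise (hs.measurable t) (hs.law t), inner_zero_right]
    have hnext : MemLp (fun ω => β • A ω + (1 - β) • a ω) 2 μ :=
      (hA.const_smul β).add (ha.const_smul (1 - β))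
    refine ⟨hnext, ?_⟩
    have hA2 : Integrable (fun ω => β ^ 2 * ‖A ω‖ ^ 2) μ := hA.norm.integrable_sq.const_mul _
    have ha2 : Integrable (fun ω => (1 - β) ^ 2 * ‖a ω‖ ^ 2) μ := ha.norm.integrable_sq.const_mul _
    have hin2 : Integrable (fun ω => 2 * (β * (1 - β)) * inner ℝ (A ω) (a ω)) μ := hin.const_mul _
    have h12 : Integrable (fun ω => β ^ 2 * ‖A ω‖ ^ 2
        + 2 * (β * (1 - β)) * inner ℝ (A ω) (a ω)) μ := hA2.add hin2
    have e : ∀ ω, ‖movingAverage β (fun s => smallNoise gf g Λ (snmPoint f g w₀ γ β sample s ω)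
        fun i => sample s i ω) (t + 1)‖ ^ 2 = β ^ 2 * ‖A ω‖ ^ 2
          + 2 * (β * (1 - β)) * inner ℝ (A ω) (a ω) + (1 - β) ^ 2 * ‖a ω‖ ^ 2 := fun ω => by
      change ‖β • A ω + (1 - β) • a ω‖ ^ 2 = _
      rw [norm_add_sq_real, norm_smul, norm_smul, real_inner_smul_left, real_inner_smul_right,
        mul_pow, mul_pow, Real.norm_eq_abs, Real.norm_eq_abs, sq_abs, sq_abs]
      ring
    simp only [e]
    rw [integral_add h12 ha2, integral_add hA2 hin2, integral_const_mul, integral_const_mul,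
      integral_const_mul, horth]
    have h1 := mul_le_mul_of_nonneg_left hAle (sq_nonneg β)
    have h2 := mul_le_mul_of_nonneg_left hale (sq_nonneg (1 - β))
    have h3 : 0 ≤ (1 - β) ^ 2 * β * v := by positivity
    nlinarith

/-- The convergence of SNM in expectation. -/
theorem sum_integral_norm_g_snmPoint_le (hs : IsIIDSample μ P sample) (hS : 768 ≤ S) (w₀ : W)
    {γ β ε Δ : ℝ} (hγ : 0 < γ) (hβ0 : 0 ≤ β) (hβ1 : β < 1) (hε : 0 ≤ ε)
    (hγ₀ : 24 * (γ * K₀) ≤ (1 - β) * ε) (hγ₁ : 24 * (γ * K₁) ≤ 1 - β)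
    (hβΛ : (1 - β) * Λ ^ 2 ≤ ε ^ 2) (hF : BddBelow (Set.range F))
    (hΔ : F w₀ - ⨅ w, F w ≤ Δ) {N : ℕ} (hN : 4 * Δ ≤ γ * ε * N) :
    ∑ t ∈ Finset.range N, ∫ ω, ‖g (snmPoint f g w₀ γ β sample t ω)‖ ∂μ ≤ 2 / 3 * (N * ε) := by
  set a : ℕ → Ω → W := fun t ω => smallNoise gf g Λ (snmPoint f g w₀ γ β sample t ω)
      fun i => sample t i ω with ha
  set b : ℕ → Ω → W := fun t ω => largeNoise gf g Λ (snmPoint f g w₀ γ β sample t ω)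
      fun i => sample t i ω with hb
  have hpath : ∀ ω, 7 / 8 * ∑ t ∈ Finset.range N, ‖g (snmPoint f g w₀ γ β sample t ω)‖
      ≤ Δ / γ + N * ε / 8 + 2 * ∑ t ∈ Finset.range N, ‖b t ω‖
        + 2 * ∑ t ∈ Finset.range N, ‖movingAverage β (fun s => a s ω) (t + 1)‖ := fun ω => by
    refine sum_norm_gradient_le (F := F)
      (m := fun t => (snm f w₀ (g w₀) γ β (fun t i => sample t i ω) t).momentum)
      h.lip h.desc h.K₀_nonneg h.K₁_nonneg hγ hβ0 hβ1 hγ₀ hγ₁ rfl (fun t => ?_)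
      (fun t => rfl) N (le_trans ?_ hΔ)
    · simp only [snm, snmStep, h.batchGradient_eq_add (by omega : 0 < S) Λ]
      rfl
    · exact sub_le_sub_left (ciInf_le hF _) _
  have hg := fun t => h.integrable_g_snmPoint hs w₀ hγ.le β t
  have hbi := fun t => h.largeNoise_snm hs hS w₀ hγ.le β t
  have hAi := fun t => h.movingAverage_snm hs w₀ γ hβ0 hβ1 t
  have hAint : ∀ t, Integrable (fun ω => ‖movingAverage β (fun s => a s ω) t‖) μ := fun t =>
    ((hAi t).1.integrable one_le_two).norm
  -- The second moment is at most 3(1 - β)Λ²/S ≤ 3ε²/768 = (ε/16)².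
  have hAle : ∀ t, ∫ ω, ‖movingAverage β (fun s => a s ω) t‖ ∂μ ≤ ε / 16 := fun t => by
    refine abs_le_of_sq_le_sq' ?_ (by positivity) |>.2
    refine (sq_integral_norm_le (hAi t).1).trans ((hAi t).2.trans ?_)
    have h5 : (S : ℝ)⁻¹ ≤ 1 / 768 := by
      rw [inv_eq_one_div]
      exact one_div_le_one_div_of_le (by norm_num) (by exact_mod_cast hS)
    have h6 : 0 ≤ 3 * ((1 - β) * Λ ^ 2) :=
      mul_nonneg (by norm_num) (mul_nonneg (sub_nonneg.2 hβ1.le) (sq_nonneg _))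
    have := mul_le_mul_of_nonneg_right h5 h6
    nlinarith
  have hint : 7 / 8 * ∑ t ∈ Finset.range N, ∫ ω, ‖g (snmPoint f g w₀ γ β sample t ω)‖ ∂μ
      ≤ Δ / γ + N * ε / 8 + 2 * ∑ t ∈ Finset.range N, ∫ ω, ‖b t ω‖ ∂μ
        + 2 * ∑ t ∈ Finset.range N, ∫ ω, ‖movingAverage β (fun s => a s ω) (t + 1)‖ ∂μ := by
    have hi1 : Integrable (fun ω => 2 * ∑ t ∈ Finset.range N, ‖b t ω‖) μ :=
      (integrable_finsetSum _ fun t _ => (hbi t).1).const_mul 2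
    have hi2 : Integrable (fun ω => 2 * ∑ t ∈ Finset.range N,
        ‖movingAverage β (fun s => a s ω) (t + 1)‖) μ :=
      (integrable_finsetSum _ fun t _ => hAint (t + 1)).const_mul 2
    have hi3 : Integrable (fun ω => Δ / γ + N * ε / 8
        + 2 * ∑ t ∈ Finset.range N, ‖b t ω‖) μ := (integrable_const _).add hi1
    have := integral_mono ((integrable_finsetSum (Finset.range N) fun t _ => hg t).const_mul (7 / 8))
      (hi3.add hi2) hpath
    rw [integral_const_mul, integral_finsetSum _ fun t _ => hg t] at this
    refine this.trans (le_of_eq ?_)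
    change ∫ ω, (Δ / γ + N * ε / 8 + 2 * ∑ t ∈ Finset.range N, ‖b t ω‖
        + 2 * ∑ t ∈ Finset.range N, ‖movingAverage β (fun s => a s ω) (t + 1)‖) ∂μ = _
    rw [integral_add hi3 hi2, integral_add (integrable_const _) hi1, integral_const_mul,
      integral_const_mul, integral_finsetSum _ fun t _ => (hbi t).1,
      integral_finsetSum _ fun t _ => hAint (t + 1)]
    simp [hb]
  have hbs : ∑ t ∈ Finset.range N, ∫ ω, ‖b t ω‖ ∂μ
      ≤ (∑ t ∈ Finset.range N, ∫ ω, ‖g (snmPoint f g w₀ γ β sample t ω)‖ ∂μ) / 16 := by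
    rw [Finset.sum_div]
    exact Finset.sum_le_sum fun t _ => (hbi t).2
  have hAs : ∑ t ∈ Finset.range N, ∫ ω, ‖movingAverage β (fun s => a s ω) (t + 1)‖ ∂μ
      ≤ N * (ε / 16) := by
    refine (Finset.sum_le_sum fun t _ => hAle (t + 1)).trans (le_of_eq ?_)
    simp
  -- With X the sum of expected gradient norms, the terms add up to 7X/8 ≤ Nε/4 + Nε/8 + X/8 + Nε/8,
  -- that is X ≤ 2Nε/3.
  have hΔγ : Δ / γ ≤ N * ε / 4 := by
    rw [div_le_iff₀ hγ]; linarith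
  linarith

end IsStochasticObjective
end Iterates
end DRO

/-! ### Choice of the parameters and conclusion. -/

namespace DRO

theorem gradCalls_snm {W Ξ : Type*} [NormedAddCommGroup W] [InnerProductSpace ℝ W]
    [CompleteSpace W] (f : W → Ξ → ℝ) (w₀ m₀ : W) (γ β : ℝ) {S : ℕ} (sample : ℕ → Fin S → Ξ)
    (t : ℕ) : (snm f w₀ m₀ γ β sample t).gradCalls = t * S := by
  induction t with
  | zero => simp [snm]
  | succ t ih => simp only [snm, snmStep, ih]; ring

/-- The parameters of SNM for smoothness `4 M G² / lam + L` and noise level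
`2 G² (M² σ² / lam² + 1)`. -/
theorem exists_snm_parameters {G L M σ lam Δ ε : ℝ} (hL : 0 ≤ L) (hM : 0 ≤ M)
    (hlam : 0 < lam) (hΔ : 0 ≤ Δ) (hε : 0 < ε) (hεG : ε < G) :
    ∃ γ : ℝ, 0 < γ ∧ ∃ β : ℝ, 0 ≤ β ∧ β < 1 ∧ ∃ T : ℕ,
      24 * (γ * (4 * (M / lam) * G ^ 2 + L)) ≤ (1 - β) * ε ∧ 24 * (γ * (L / G)) ≤ 1 - β ∧
      (1 - β) * (2 * G ^ 2 * ((M / lam) ^ 2 * σ ^ 2 + 1)) ≤ ε ^ 2 ∧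
      4 * Δ ≤ γ * ε * ((T + 1 : ℕ) : ℝ) ∧
      (T : ℝ) * 768 ≤ 589824 * (G ^ 2 * (M ^ 2 * σ ^ 2 * lam⁻¹ ^ 2 + 1) * (lam⁻¹ * M * G ^ 2 + L)
        * Δ * ε⁻¹ ^ 4) := by
  have hG : 0 < G := hε.trans hεG
  set V := 2 * G ^ 2 * ((M / lam) ^ 2 * σ ^ 2 + 1) with hV
  set K := 4 * (M / lam) * G ^ 2 + L with hK
  have hMl : 0 ≤ M / lam := div_nonneg hM hlam.le
  have hV0 : 0 < V := by positivity
  have hεV : ε ^ 2 ≤ V := by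
    have h1 : ε ^ 2 ≤ G ^ 2 := pow_le_pow_left₀ hε.le hεG.le 2
    have h2 : 0 ≤ G ^ 2 * ((M / lam) ^ 2 * σ ^ 2) := by positivity
    nlinarith
  -- This is 1 - β; ε < G ensures α ≤ 1.
  set α := ε ^ 2 / V with hα
  have hα0 : 0 < α := by positivity
  have hα1 : α ≤ 1 := (div_le_one hV0).2 hεV
  have hαV : α * V = ε ^ 2 := div_mul_cancel₀ _ hV0.ne'
  have hK0 : 0 ≤ K := by positivity
  have hLK : L / G * ε ≤ K := by
    have : L / G * ε ≤ L := by
      rw [div_mul_eq_mul_div, div_le_iff₀ hG]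
      exact mul_le_mul_of_nonneg_left hεG.le hL
    have : 0 ≤ 4 * (M / lam) * G ^ 2 := by positivity
    linarith
  rcases hK0.eq_or_lt with hK1 | hK1
  · have hL0 : L = 0 := by
      have : 0 ≤ 4 * (M / lam) * G ^ 2 := by positivity
      linarith
    -- Zero smoothness constant: the complexity bound is 0, so T = 0 is forced. Any step size is
    -- admissible, and this one makes γε exceed 4Δ.
    refine ⟨4 * Δ / ε + 1, by positivity, 1 - α, by linarith, by linarith, 0, ?_, ?_, ?_, ?_, ?_⟩
    · rw [← hK1]; simp; positivity
    · simp [hL0, hα0.le]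
    · simp [hαV]
    · have : (4 * Δ / ε + 1) * ε = 4 * Δ + ε := by field_simp
      simp only [zero_add, Nat.cast_one, mul_one]
      linarith
    · simp only [Nat.cast_zero, zero_mul]
      positivity
  · set γ := α * ε / (24 * K) with hγ
    have hγ0 : 0 < γ := by positivity
    have hγK : 24 * (γ * K) = α * ε := by rw [hγ]; field_simp
    -- T is rounded down because T + 1 points are averaged: the analysis uses N = T + 1 steps, of
    -- which the last need not be run. This keeps the complexity bound free of an additive constant.
    refine ⟨γ, hγ0, 1 - α, by linarith, by linarith, ⌊4 * Δ / (γ * ε)⌋₊, ?_, ?_, ?_, ?_, ?_⟩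
    · rw [hγK]; simp
    · rw [sub_sub_cancel]
      refine le_of_mul_le_mul_right ?_ hε
      have := mul_le_mul_of_nonneg_left hLK hγ0.le
      linarith
    · simp [hαV]
    · have := (Nat.lt_floor_add_one (4 * Δ / (γ * ε))).le
      rw [div_le_iff₀ (by positivity)] at this
      push_cast
      linarith
    · have h1 := Nat.floor_le (show 0 ≤ 4 * Δ / (γ * ε) by positivity)
      have h2 : 4 * Δ / (γ * ε) = 96 * Δ * K * V / ε ^ 4 := by
        rw [hγ, hα]; field_simp; ring
      have h3 : K ≤ 4 * (lam⁻¹ * M * G ^ 2 + L) := by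
        have : 4 * (M / lam) * G ^ 2 = 4 * (lam⁻¹ * M * G ^ 2) := by ring
        linarith
      have h4 : 96 * Δ * K * V / ε ^ 4 ≤ 96 * Δ * (4 * (lam⁻¹ * M * G ^ 2 + L)) * V / ε ^ 4 := by
        gcongr
      calc (⌊4 * Δ / (γ * ε)⌋₊ : ℝ) * 768
          ≤ 96 * Δ * (4 * (lam⁻¹ * M * G ^ 2 + L)) * V / ε ^ 4 * 768 := by
            rw [h2] at h1
            rw [h2]
            linarith
        _ = _ := by rw [hV]; field_simp; ring

section Main

variable {Ξ : Type*} {d : ℕ} [MeasurableSpace Ξ] {G L M σ lam : ℝ} {P : Measure Ξ}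
  [IsProbabilityMeasure P] {loss : Param d → Ξ → ℝ} {ψ : ℝ → ℝ≥0∞}

theorem IsDROProblem.isStochasticObjective (h : IsDROProblem G L M σ lam P loss ψ) (hG : 0 < G) :
    IsStochasticObjective P (rescaledDualSample loss ψ lam G) (rescaledDual loss ψ lam G P)
      (dualGradSample loss ψ lam G) (dualGrad loss ψ lam G P)
      (4 * (M / lam) * G ^ 2 + L) (L / G) (√(2 * G ^ 2 * ((M / lam) ^ 2 * σ ^ 2 + 1))) where
  K₀_nonneg := by
    have := div_nonneg h.M_nonneg h.lam_pos.le
    have := h.L_nonneg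
    positivity
  K₁_nonneg := div_nonneg h.L_nonneg hG.le
  Λ_nonneg := Real.sqrt_nonneg _
  gradient_eq := h.gradient_rescaledDualSample
  measurable := h.measurable_uncurry_dualGradSample
  memLp := h.memLp_dualGradSample
  mean := fun _ => rfl
  noise := fun w => by
    rw [Real.sq_sqrt (by positivity)]
    exact h.integral_norm_dualGradSample_sub_sq_le w
  lip := h.norm_dualGrad_sub_le hG
  desc := h.rescaledDual_le hG

theorem measurable_gradient {E : Type*} [NormedAddCommGroup E] [InnerProductSpace ℝ E]
    [CompleteSpace E] [MeasurableSpace E] [BorelSpace E] (f : E → ℝ) :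
    Measurable (gradient f) :=
  (InnerProductSpace.toDual ℝ E).symm.continuous.measurable.comp (measurable_fderiv ℝ f)

theorem IsDROProblem.integrable_norm_gradient {Ω : Type*} [MeasurableSpace Ω] {μ : Measure Ω}
    [IsProbabilityMeasure μ] (h : IsDROProblem G L M σ lam P loss ψ) {w : Ω → DualParam d}
    (hw : Measurable w) :
    Integrable (fun ω => ‖gradient (penalizedObjectiveReal loss ψ lam P) (w ω).fst‖) μ := by
  refine (integrable_const G).mono' ((measurable_gradient _).comp
    ((WithLp.continuous_fst 2 _ _).measurable.comp hw)).norm.aestronglyMeasurable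
    (Filter.Eventually.of_forall fun ω => ?_)
  simpa using h.norm_gradient_penalizedObjectiveReal_le (w ω).fst

/-- SNM finds an `ε`-stationary point of the objective in expectation. -/
theorem IsDROProblem.sum_integral_norm_gradient_le {Ω : Type*} [MeasurableSpace Ω]
    {μ : Measure Ω} [IsProbabilityMeasure μ] (h : IsDROProblem G L M σ lam P loss ψ) (hG : 0 < G)
    {S : ℕ} (hS : 768 ≤ S) {sample : ℕ → Fin S → Ω → Ξ} (hs : IsIIDSample μ P sample)
    (w₀ : DualParam d) {γ β ε Δ : ℝ} (hγ : 0 < γ) (hβ0 : 0 ≤ β) (hβ1 : β < 1) (hε : 0 ≤ ε)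
    (hγ₀ : 24 * (γ * (4 * (M / lam) * G ^ 2 + L)) ≤ (1 - β) * ε)
    (hγ₁ : 24 * (γ * (L / G)) ≤ 1 - β)
    (hβΛ : (1 - β) * (2 * G ^ 2 * ((M / lam) ^ 2 * σ ^ 2 + 1)) ≤ ε ^ 2)
    (hF : BddBelow (Set.range (rescaledDual loss ψ lam G P)))
    (hΔ : rescaledDual loss ψ lam G P w₀ - ⨅ w, rescaledDual loss ψ lam G P w ≤ Δ) {N : ℕ}
    (hN : 4 * Δ ≤ γ * ε * N) :
    ∑ t ∈ Finset.range N, ∫ ω, ‖gradient (penalizedObjectiveReal loss ψ lam P)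
      (snmPoint (rescaledDualSample loss ψ lam G) (dualGrad loss ψ lam G P) w₀ γ β sample t ω).fst‖
        ∂μ ≤ N * ε := by
  have ho := h.isStochasticObjective hG
  have hmain := ho.sum_integral_norm_g_snmPoint_le hs hS w₀ hγ hβ0 hβ1 hε hγ₀ hγ₁
    (by rwa [Real.sq_sqrt (by positivity)]) hF hΔ hN
  have hle : ∀ t, ∫ ω, ‖gradient (penalizedObjectiveReal loss ψ lam P)
      (snmPoint (rescaledDualSample loss ψ lam G) (dualGrad loss ψ lam G P) w₀ γ β sample t ω).fst‖
        ∂μ ≤ √2 * ∫ ω, ‖dualGrad loss ψ lam G P (snmPoint (rescaledDualSample loss ψ lam G)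
          (dualGrad loss ψ lam G P) w₀ γ β sample t ω)‖ ∂μ := fun t => by
    rw [← integral_const_mul]
    exact integral_mono (h.integrable_norm_gradient (ho.measurable_snmPoint hs w₀ γ β t))
      ((ho.integrable_g_snmPoint hs w₀ hγ.le β t).const_mul _) fun ω =>
        h.norm_gradient_penalizedObjectiveReal_le_norm_dualGrad _
  refine (Finset.sum_le_sum fun t _ => hle t).trans ?_
  rw [← Finset.mul_sum]
  -- The factor 2/3 in the dual estimate leaves room for the √2 lost in passing to Ψ.
  have h2 : √2 ≤ 3 / 2 := Real.sqrt_le_left (by norm_num) |>.2 (by norm_num)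
  calc _ ≤ 3 / 2 * (2 / 3 * (N * ε)) := mul_le_mul h2 hmain
        (Finset.sum_nonneg fun t _ => integral_nonneg fun ω => norm_nonneg _) (by norm_num)
    _ = _ := by ring

end Main

end DRO

theorem mainTheorem2 :
    ∃ S : ℕ, 0 < S ∧ ∃ C : ℝ, 0 < C ∧
    ∀ G L M σ lam Δ ε : ℝ,
      0 ≤ G → 0 ≤ L → 0 ≤ M → 0 ≤ σ → 0 < lam → 0 ≤ Δ → 0 < ε →
    ∃ γ : ℝ, 0 < γ ∧ ∃ β : ℝ, 0 ≤ β ∧ β < 1 ∧ ∃ T : ℕ,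
    ∀ (d : ℕ) (Ξ : Type*) [MeasurableSpace Ξ] (P : Measure Ξ) [IsProbabilityMeasure P]
      (loss : DRO.Param d → Ξ → ℝ) (ψ : ℝ → ℝ≥0∞),
      DRO.IsLipschitzSmoothLoss G L loss →
      DRO.IsDivergenceFunction ψ →
      DRO.HasSmoothConjugate M ψ →
      DRO.HasVarianceBound σ P loss →
      -- the objective is finite and differentiable, so that stationarity makes sense
      (∀ x, DRO.penalizedObjective loss ψ lam P x ≠ ⊥ ∧
        DRO.penalizedObjective loss ψ lam P x ≠ ⊤) ∧
      Differentiable ℝ (DRO.penalizedObjectiveReal loss ψ lam P) ∧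
      ∀ w₀ : DRO.DualParam d,
        BddBelow (Set.range (DRO.rescaledDual loss ψ lam G P)) →
        DRO.rescaledDual loss ψ lam G P w₀ - (⨅ w, DRO.rescaledDual loss ψ lam G P w) ≤ Δ →
        ∀ (Ω : Type*) [MeasurableSpace Ω] (μ : Measure Ω) [IsProbabilityMeasure μ]
          (sample : ℕ → Fin S → Ω → Ξ), DRO.IsIIDSample μ P sample →
          let run : Ω → ℕ → DRO.SNMState (DRO.DualParam d) := fun ω =>
            DRO.snm (DRO.rescaledDualSample loss ψ lam G) w₀
              (gradient (DRO.rescaledDual loss ψ lam G P) w₀) γ β (fun t i => sample t i ω)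
          let gradNorm : ℕ → Ω → ℝ := fun t ω =>
            ‖gradient (DRO.penalizedObjectiveReal loss ψ lam P) (run ω t).point.fst‖
          (∀ ω, ((run ω T).gradCalls : ℝ) ≤
            C * (G ^ 2 * (M ^ 2 * σ ^ 2 * lam⁻¹ ^ 2 + 1) * (lam⁻¹ * M * G ^ 2 + L)
              * Δ * ε⁻¹ ^ 4)) ∧
          (∀ t ≤ T, Integrable (gradNorm t) μ) ∧
          (1 / ((T : ℝ) + 1)) * ∑ t ∈ Finset.range (T + 1), ∫ ω, gradNorm t ω ∂μ ≤ ε := by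
  refine ⟨768, by norm_num, 589824, by norm_num, ?_⟩
  intro G L M σ lam Δ ε hG hL hM _ hlam hΔ hε
  -- If G ≤ ε every point is ε-stationary and T = 0 works. This also covers G = 0, so that L/G is
  -- used only for G > 0.
  rcases le_or_gt G ε with hGε | hεG
  · refine ⟨1, one_pos, 0, le_rfl, one_pos, 0, ?_⟩
    intro d Ξ _ P _ loss ψ hloss hψ hc hvar
    have h : DRO.IsDROProblem G L M σ lam P loss ψ := ⟨hG, hL, hM, hlam, hloss, hψ, hc, hvar⟩
    refine ⟨h.penalizedObjective_ne, h.differentiable_penalizedObjectiveReal, ?_⟩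
    intro w₀ _ _ Ω _ μ _ sample _
    refine ⟨fun ω => ?_, fun t ht => ?_, ?_⟩
    · simp only [DRO.snm, Nat.cast_zero]
      positivity
    · obtain rfl : t = 0 := Nat.le_zero.1 ht
      exact h.integrable_norm_gradient (measurable_const (a := w₀))
    · simp only [DRO.snm, zero_add, Finset.range_one, Finset.sum_singleton, integral_const]
      simpa using (h.norm_gradient_penalizedObjectiveReal_le w₀.fst).trans hGε
  · have hG0 := hε.trans hεG
    obtain ⟨γ, hγ, β, hβ0, hβ1, T, hγ₀, hγ₁, hβΛ, hN, hT⟩ :=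
      DRO.exists_snm_parameters (σ := σ) hL hM hlam hΔ hε hεG
    refine ⟨γ, hγ, β, hβ0, hβ1, T, ?_⟩
    intro d Ξ _ P _ loss ψ hloss hψ hc hvar
    have h : DRO.IsDROProblem G L M σ lam P loss ψ := ⟨hG, hL, hM, hlam, hloss, hψ, hc, hvar⟩
    refine ⟨h.penalizedObjective_ne, h.differentiable_penalizedObjectiveReal, ?_⟩
    intro w₀ hF hΔ' Ω _ μ _ sample hs
    -- Identifies the initial momentum with `dualGrad`, so that the run is the sequence `snmPoint`
    -- of the analysis.
    simp only [h.gradient_rescaledDual]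
    refine ⟨fun ω => ?_, fun t _ => ?_, ?_⟩
    · rw [DRO.gradCalls_snm]
      push_cast
      exact hT
    · exact h.integrable_norm_gradient
        ((h.isStochasticObjective hG0).measurable_snmPoint hs w₀ γ β t)
    · have hsum := h.sum_integral_norm_gradient_le hG0 le_rfl hs w₀ hγ hβ0 hβ1 hε.le hγ₀ hγ₁ hβΛ
        hF hΔ' hN
      push_cast at hsum
      rw [one_div, inv_mul_le_iff₀ (by positivity)]
      exact hsum
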